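/- Let $k\ge 1$ and $s\ge -\tfrac12$, and let $\mathcal P(\mathbb R^{+k})$ be the set of Borel probability measures on the cone $\mathbb R^{+k}=[0,\infty)^k$, with Euclidean norm $\|\cdot\|$. \emph{Definitions.} For $x,y\ge 0$ let $\delta_x\circ_s\delta_y$ be the law of $(x^2+2uxy+y^2)^{1/2}$, where $u$ is distributed on $[-1,1]$ with density $\frac{\Gamma(s+1)}{\sqrt\pi\,\Gamma(s+1/2)}(1-u^2)^{s-1/2}$ (for $s=-\tfrac12$: $u=\pm1$ with probability $\tfrac12$ each). For $\mathbf x,\mathbf y\in\mathbb R^{+k}$ put $\delta_{\mathbf x}\bigcirc_{s,k}\delta_{\mathbf y}=(\delta_{x_1}\circ_s\delta_{y_1})\times\cdots\times(\delta_{x_k}\circ_s\delta_{y_k})$, and for $G_1,G_2\in\mathcal P(\mathbb R^{+k})$ put $G_1\bigcirc_{s,k}G_2=\iint \delta_{\mathbf x}\bigcirc_{s,k}\delta_{\mathbf y}\,G_1(d\mathbf x)\,G_2(d\mathbf y)$. A measure $\mu\in\mathcal P(\mathbb R^{+k})$ is $\bigcirc_{s,k}$-infinitely divisible if for every $m=1,2,\dots$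 there is $\mu_m\in\mathcal P(\mathbb R^{+k})$ whose $m$-fold $\bigcirc_{s,k}$-power is $\mu$. Let $\Lambda_s(x)=\Gamma(s+1)J_s(x)/(x/2)^s$ for $x>0$ and $\Lambda_s(0)=1$, where $J_s$ is the Bessel function of the first kind, and let $\hat\mu(\mathbf t)=\int\prod_{j=1}^k\Lambda_s(t_jx_j)\,\mu(d\mathbf x)$, $\mathbf t\in\mathbb R^{+k}$. Let $\sigma_s$ be the law on $(0,\infty)$ with density $\frac{2(s+1)^{s+1}}{\Gamma(s+1)}x^{2s+1}e^{-(s+1)x^2}$. A law is Rayleighian if it equals $T_{\lambda_1}\sigma_s\times\cdots\times T_{\lambda_k}\sigma_s$ for some $\lambda_j\ge0$, where $T_c$ denotes the image under $x\mapsto cx$. \emph{Representation.} Say that $\mu\in\mathcal P(\mathbb R^{+k})$ is represented by a pair $[M,\lambda]$ if $\lambda=(\lambda_1,\dots,\lambda_k)$ with $\lambda_j\ge0$; $M$ is a $\sigma$-finite Borel measure on $\mathbb R^{+k}$ with $M(\{\mathbf 0\})=0$, finite outside every neighbourhood of $\mathbf 0$, with $\int\frac{\|\mathbf x\|^2}{1+\|\mathbf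 x\|^2}M(d\mathbf x)<\infty$; and, for every $\mathbf t\in\mathbb R^{+k}$, $\hat\mu(\mathbf t)>0$, the integral below converges, and $$-\log\hat\mu(\mathbf t)=\sum_{j=1}^k\lambda_j^2t_j^2+\int_{\mathbb R^{+k}\setminus\{\mathbf 0\}}\Bigl(1-\prod_{j=1}^k\Lambda_s(t_jx_j)\Bigr)\frac{1+\|\mathbf x\|^2}{\|\mathbf x\|^2}\,M(d\mathbf x).$$ \textbf{Theorem.} Let $\mu\in\mathcal P(\mathbb R^{+k})$. Then: (i) $\mu$ is $\bigcirc_{s,k}$-infinitely divisible if and only if it is represented by some pair $[M,\lambda]$. (ii) The representation is unique: if $\mu$ is represented by $[M,\lambda]$ and by $[M',\lambda']$, then $M=M'$ and $\lambda=\lambda'$. (iii) $\mu$ is represented by $[0,\lambda]$ for some $\lambda$ if and only if $\mu$ is Rayleighian; and $\mu$ is Rayleighian if and only if there are $\lambda_j\ge0$ with $\hat\mu(\mathbf t)>0$ and $-\log\hat\mu(\mathbf t)=\frac12\sum_{j=1}^k\lambda_j^2t_j^2$ for all $\mathbf t\in\mathbb R^{+k}$. -/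

import Mathlib

open MeasureTheory Set Filter Topology
open scoped NNReal ENNReal

/-- Bessel function of the first kind, `J_s(x) = ∑ (-1)^m (x/2)^(s+2m) / (m! Γ(s+m+1))`, `x > 0`. -/
noncomputable def besselJ (s x : ℝ) : ℝ :=
  ∑' m : ℕ, (-1) ^ m * (x / 2) ^ (s + 2 * (m : ℝ)) / ((m.factorial : ℝ) * Real.Gamma (s + m + 1))

/-- The kernel `Λ_s(x) = Γ(s+1) J_s(x) / (x/2)^s`, written as a power series so that it has the
right value `1` at `x = 0`; see `kingmanKernel_eq_besselJ`. -/
noncomputable def kingmanKernel (s x : ℝ) : ℝ :=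
  ∑' m : ℕ, (-1) ^ m * Real.Gamma (s + 1) / ((m.factorial : ℝ) * Real.Gamma (s + m + 1))
    * (x / 2) ^ (2 * m)

theorem kingmanKernel_eq_besselJ (s : ℝ) {x : ℝ} (hx : 0 < x) :
    kingmanKernel s x = Real.Gamma (s + 1) * besselJ s x / (x / 2) ^ s := by
  have h2 : 0 < x / 2 := by positivity
  have hs : (x / 2) ^ s ≠ 0 := (Real.rpow_pos_of_pos h2 s).ne'
  unfold kingmanKernel besselJ
  rw [← tsum_mul_left, ← tsum_div_const]
  refine tsum_congr fun m => ?_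
  have : (x / 2) ^ (s + 2 * (m : ℝ)) = (x / 2) ^ s * (x / 2) ^ (2 * m) := by
    rw [Real.rpow_add h2, ← Real.rpow_natCast (x / 2) (2 * m)]
    push_cast
    rfl
  rw [this]
  field_simp

theorem kingmanKernel_zero {s : ℝ} (hs : -(1 / 2) ≤ s) : kingmanKernel s 0 = 1 := by
  have hG : Real.Gamma (s + 1) ≠ 0 := (Real.Gamma_pos_of_pos (by linarith)).ne'
  unfold kingmanKernel
  rw [tsum_eq_single 0]
  · simp [hG]
  · intro m hm
    simp [hm]

/-- The law of the cosine `u` of the angle in the Kingman convolution: density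
`Γ(s+1) / (√π Γ(s+1/2)) (1-u²)^(s-1/2)` on `(-1, 1)` for `s > -1/2`, and its weak limit, the
uniform law on `{-1, 1}`, for `s = -1/2`. -/
noncomputable def angleLaw (s : ℝ) : Measure ℝ :=
  if s = -(1 / 2) then
    (2⁻¹ : ℝ≥0∞) • Measure.dirac (-1) + (2⁻¹ : ℝ≥0∞) • Measure.dirac 1
  else
    (volume.restrict (Ioo (-1) 1)).withDensity fun u =>
      ENNReal.ofReal (Real.Gamma (s + 1) / (Real.sqrt Real.pi * Real.Gamma (s + 1 / 2))
        * (1 - u ^ 2) ^ (s - 1 / 2))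

theorem isProbabilityMeasure_angleLaw {s : ℝ} (hs : -(1 / 2) ≤ s) :
    IsProbabilityMeasure (angleLaw s) := by
  constructor
  unfold angleLaw
  split_ifs with h
  · simp [ENNReal.inv_two_add_inv_two]
  · have ha : 0 < s + 1 / 2 := by
      rcases lt_or_eq_of_le hs with h1 | h1
      · linarith
      · exact absurd h1.symm h
    rw [withDensity_apply _ MeasurableSet.univ, Measure.restrict_univ]
    have himg : (fun v : ℝ => 2 * v + (-1)) '' Ioo 0 1 = Ioo (-1) 1 := by
      rw [Set.image_affine_Ioo (by norm_num)]
      norm_num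
    rw [← himg, lintegral_image_eq_lintegral_abs_deriv_mul (f' := fun _ => 2) measurableSet_Ioo
      (fun x _ => by
        simpa using (((hasDerivAt_id x).const_mul 2).add_const (-1)).hasDerivWithinAt)
      (fun x _ y _ hxy => by simpa using hxy)]
    rw [← ProbabilityTheory.lintegral_betaPDF_eq_one ha ha, ProbabilityTheory.lintegral_betaPDF]
    refine setLIntegral_congr_fun measurableSet_Ioo fun v hv => ?_
    have hv0 : 0 < v := hv.1
    have hv1 : 0 < 1 - v := by linarith [hv.2]
    rw [← ENNReal.ofReal_mul (abs_nonneg _)]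
    congr 1
    have hsq : 1 - (2 * v + -1) ^ 2 = 2 ^ (2 : ℝ) * (v * (1 - v)) := by
      norm_num
      ring
    have hG := Real.Gamma_mul_Gamma_add_half (s + 1 / 2)
    have e1 : s + 1 / 2 + 1 / 2 = s + 1 := by ring
    have e2 : s + 1 / 2 - 1 = s - 1 / 2 := by ring
    have e3 : s + 1 / 2 + (s + 1 / 2) = 2 * (s + 1 / 2) := by ring
    rw [e1] at hG
    rw [hsq, Real.mul_rpow (by positivity) (by positivity), Real.mul_rpow hv0.le hv1.le,
      ← Real.rpow_mul (by norm_num), ProbabilityTheory.beta, e2, e3]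
    have h1 : 0 < Real.Gamma (s + 1 / 2) := Real.Gamma_pos_of_pos ha
    have h2 : 0 < Real.Gamma (2 * (s + 1 / 2)) := Real.Gamma_pos_of_pos (by linarith)
    have h3 : 0 < Real.sqrt Real.pi := Real.sqrt_pos.mpr Real.pi_pos
    have h4 : Real.Gamma (s + 1) =
        Real.Gamma (2 * (s + 1 / 2)) * 2 ^ (1 - 2 * (s + 1 / 2)) * Real.sqrt Real.pi
          / Real.Gamma (s + 1 / 2) := by
      rw [eq_div_iff h1.ne', mul_comm, hG]
    have h5 : (2 : ℝ) ^ (1 - 2 * (s + 1 / 2)) * 2 ^ (2 * (s - 1 / 2)) * 2 = 1 := by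
      rw [← Real.rpow_add (by norm_num), ← Real.rpow_add_one (by norm_num)]
      have : 1 - 2 * (s + 1 / 2) + 2 * (s - 1 / 2) + 1 = 0 := by ring
      rw [this, Real.rpow_zero]
    rw [h4, abs_of_pos (by norm_num : (0 : ℝ) < 2)]
    generalize Real.Gamma (s + 1 / 2) = A at h1 ⊢
    generalize Real.Gamma (2 * (s + 1 / 2)) = B at h2 ⊢
    generalize Real.sqrt Real.pi = C at h3 ⊢
    generalize (2 : ℝ) ^ (1 - 2 * (s + 1 / 2)) = D at h5 ⊢
    generalize (2 : ℝ) ^ (2 * (s - 1 / 2)) = E at h5 ⊢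
    generalize v ^ (s - 1 / 2) = V
    generalize (1 - v) ^ (s - 1 / 2) = W
    have hL : 2 * (B * D * C / A / (C * A) * (E * (V * W))) =
        (D * E * 2) * (B / (A * A) * V * W) := by
      field_simp
    have hR : 1 / (A * A / B) * V * W = B / (A * A) * V * W := by
      field_simp
    rw [hL, h5, hR, one_mul]

/-- Law of cosines: the side `(x² + 2uxy + y²)^(1/2)`. -/
noncomputable def lawOfCosines (x y : ℝ≥0) (u : ℝ) : ℝ≥0 :=
  NNReal.sqrt (Real.toNNReal ((x : ℝ) ^ 2 + 2 * u * x * y + (y : ℝ) ^ 2))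

/-- The one-dimensional Kingman convolution `δ_x ∘_s δ_y` of two unit masses. -/
noncomputable def kingmanDirac (s : ℝ) (x y : ℝ≥0) : Measure ℝ≥0 :=
  (angleLaw s).map (lawOfCosines x y)

/-- The `k`-dimensional Kingman convolution of unit masses,
`δ_x ○_{s,k} δ_y = (δ_{x_1} ∘_s δ_{y_1}) × ⋯ × (δ_{x_k} ∘_s δ_{y_k})`. -/
noncomputable def kingmanDiracPi {k : ℕ} (s : ℝ) (x y : Fin k → ℝ≥0) : Measure (Fin k → ℝ≥0) :=
  Measure.pi fun j => kingmanDirac s (x j) (y j)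

/-- The mixture in `kingmanConv` is over a measurable family. -/
theorem measurable_kingmanDiracPi {k : ℕ} {s : ℝ} (hs : -(1 / 2) ≤ s) :
    Measurable fun p : (Fin k → ℝ≥0) × (Fin k → ℝ≥0) => kingmanDiracPi s p.1 p.2 := by
  have := isProbabilityMeasure_angleLaw hs
  have hm : Measurable fun q : ((Fin k → ℝ≥0) × (Fin k → ℝ≥0)) × (Fin k → ℝ) =>
      fun j => lawOfCosines (q.1.1 j) (q.1.2 j) (q.2 j) := by
    unfold lawOfCosines
    fun_prop
  have hm1 : ∀ x y : ℝ≥0, Measurable (lawOfCosines x y) := by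
    intro x y
    unfold lawOfCosines
    fun_prop
  have key : (fun p : (Fin k → ℝ≥0) × (Fin k → ℝ≥0) => kingmanDiracPi s p.1 p.2) =
      fun p => (((Measure.pi fun _ : Fin k => angleLaw s).map (Prod.mk p)).map
        fun q : ((Fin k → ℝ≥0) × (Fin k → ℝ≥0)) × (Fin k → ℝ) =>
          fun j => lawOfCosines (q.1.1 j) (q.1.2 j) (q.2 j)) := by
    funext p
    rw [Measure.map_map hm measurable_prodMk_left]
    have : ∀ j, IsProbabilityMeasure ((angleLaw s).map (lawOfCosines (p.1 j) (p.2 j))) :=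
      fun j => Measure.isProbabilityMeasure_map (hm1 _ _).aemeasurable
    unfold kingmanDiracPi kingmanDirac
    rw [← Measure.pi_map_pi fun j => (hm1 _ _).aemeasurable]
    rfl
  rw [key]
  exact (Measure.measurable_map _ hm).comp Measurable.map_prodMk_left

/-- The `k`-dimensional Kingman convolution `G₁ ○_{s,k} G₂ = ∬ δ_x ○_{s,k} δ_y G₁(dx) G₂(dy)` of
measures on the cone `[0, ∞)^k`. -/
noncomputable def kingmanConv {k : ℕ} (s : ℝ) (G₁ G₂ : Measure (Fin k → ℝ≥0)) :
    Measure (Fin k → ℝ≥0) :=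
  (G₁.prod G₂).bind fun p => kingmanDiracPi s p.1 p.2

/-- Convolution powers; the power `0` is the unit element `δ_0`. -/
noncomputable def kingmanPow {k : ℕ} (s : ℝ) (G : Measure (Fin k → ℝ≥0)) :
    ℕ → Measure (Fin k → ℝ≥0)
  | 0 => Measure.dirac 0
  | m + 1 => kingmanConv s (kingmanPow s G m) G

/-- Infinite divisibility with respect to `○_{s,k}`. -/
def IsKingmanID {k : ℕ} (s : ℝ) (μ : Measure (Fin k → ℝ≥0)) : Prop :=
  ∀ m : ℕ, 1 ≤ m → ∃ ν : Measure (Fin k → ℝ≥0), IsProbabilityMeasure ν ∧ μ = kingmanPow s ν m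

/-- The product kernel `∏_j Λ_s(t_j x_j)`. -/
noncomputable def kingmanKernelPi {k : ℕ} (s : ℝ) (t x : Fin k → ℝ≥0) : ℝ :=
  ∏ j, kingmanKernel s ((t j : ℝ) * x j)

/-- The radial characteristic function `μ̂(t) = ∫ ∏_j Λ_s(t_j x_j) μ(dx)`. -/
noncomputable def radCharFun {k : ℕ} (s : ℝ) (μ : Measure (Fin k → ℝ≥0)) (t : Fin k → ℝ≥0) : ℝ :=
  ∫ x, kingmanKernelPi s t x ∂μ

/-- The squared Euclidean norm on the cone. -/
noncomputable def coneNormSq {k : ℕ} (x : Fin k → ℝ≥0) : ℝ := ∑ j, (x j : ℝ) ^ 2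

/-- The conditions on the measure `M`. -/
structure IsLevyMeasure {k : ℕ} (M : Measure (Fin k → ℝ≥0)) : Prop where
  sigmaFinite : SigmaFinite M
  zero : M {0} = 0
  finite_compl : ∀ U ∈ 𝓝 (0 : Fin k → ℝ≥0), M Uᶜ < ∞
  lintegral_lt_top : ∫⁻ x, ENNReal.ofReal (coneNormSq x / (1 + coneNormSq x)) ∂M < ∞

/-- The integrand away from the origin. Its value at `x = 0` is irrelevant, since `M {0} = 0`. -/
noncomputable def levyIntegrand {k : ℕ} (s : ℝ) (t x : Fin k → ℝ≥0) : ℝ :=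
  (1 - kingmanKernelPi s t x) * ((1 + coneNormSq x) / coneNormSq x)

/-- `-log μ̂(t) = ∑_j l_j² t_j² + ∫ (1 - ∏_j Λ_s(t_j x_j)) (1+‖x‖²)/‖x‖² M(dx)` for all `t`, where
`M` satisfies the conditions above and the integral converges; the sum is the contribution
of the origin. -/
structure HasLevyRep {k : ℕ} (s : ℝ) (μ M : Measure (Fin k → ℝ≥0)) (l : Fin k → ℝ≥0) : Prop where
  levy : IsLevyMeasure M
  integrable : ∀ t, Integrable (levyIntegrand s t) M
  pos : ∀ t, 0 < radCharFun s μ t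
  eq : ∀ t, -Real.log (radCharFun s μ t) =
    ∑ j, (l j : ℝ) ^ 2 * (t j : ℝ) ^ 2 + ∫ x, levyIntegrand s t x ∂M

/-- The characteristic measure `σ_s`, with density
`2 (s+1)^(s+1) / Γ(s+1) y^(2s+1) exp (-(s+1) y²)` on `(0, ∞)`. -/
noncomputable def rayleighLaw (s : ℝ) : Measure ℝ≥0 :=
  ((volume.restrict (Ioi (0 : ℝ))).withDensity fun y =>
    ENNReal.ofReal (2 * (s + 1) ^ (s + 1) / Real.Gamma (s + 1) * y ^ (2 * s + 1)
      * Real.exp (-(s + 1) * y ^ 2))).map Real.toNNReal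

/-- Rayleighian distributions `T_{l_1} σ_s × ⋯ × T_{l_k} σ_s`, where `T_c` is the scaling by `c`. -/
def IsRayleighian {k : ℕ} (s : ℝ) (μ : Measure (Fin k → ℝ≥0)) : Prop :=
  ∃ l : Fin k → ℝ≥0, μ = Measure.pi fun j => (rayleighLaw s).map fun x => l j * x

/-! The kernel `Λ_s` is the cosine transform of the angle law, and the even moments of that law give
the product formula `integral_kingmanKernel_kingmanDirac`. Hence `radCharFun` turns the convolution
into multiplication (`radCharFun_kingmanConv`).

The kernel is symmetric in `t` and `x`, and the transform of a Rayleigh product is Gaussian.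
Averaging a transform over `t` with a Rayleigh product therefore gives the integral of `exp (-∑ a_j
x_j²)`. These functions span an algebra that separates points, so transforms determine finite
measures (`ext_of_radCharFun`). The same averaging gives tightness from bounds on the transform
(`HasUniformQuadraticBound.exists_isCompact`) and uniqueness of the pair (`HasLevyRep.unique`): the
averaged `λ`-term is linear in `a`, so a second difference in `a` removes it and leaves the Gaussian
integrals of `M` times a weight positive off the origin.

If `μ` is infinitely divisible, choose roots `ν_n` of order `n + 1` with nonnegative transforms.
Then `(n + 1) (1 - ν̂_n) → -log μ̂`. The measures `(n + 1) ν_n`, weighted by `‖x‖² / (1 + ‖x‖²)`,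
are tight and of bounded mass, but a limit may charge the origin, where the integrand has only
directional limits. The origin is therefore blown up: the point `x` is paired with `(x_j² / ‖x‖²)_j`
in a compact cube, and the integrand extends continuously (`continuous_levyBlowup`). The
second-order term of `1 - ∏ Λ_s` is `∑ t_j² x_j² / (4 (s + 1))`, with no cross terms, so the mass
over the origin yields exactly `∑ λ_j² t_j²` (`exists_rep_of_blowup`).

Conversely, an exponent whose `M` stays away from the origin belongs to a Rayleigh product convolved
with a compound Poisson law. Tightness gives the general exponent as a limit
(`exists_radCharFun_eq_exp`), and dividing an exponent by `m` gives an `m`-th root. -/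

/-! ### Rising factorials and the Chu-Vandermonde identity. -/

/-- The rising factorial `a (a + 1) ⋯ (a + n - 1)`. -/
noncomputable def risingFactorial (a : ℝ) (n : ℕ) : ℝ := ∏ i ∈ Finset.range n, (a + i)

@[simp] lemma risingFactorial_zero (a : ℝ) : risingFactorial a 0 = 1 := by
  simp [risingFactorial]

lemma risingFactorial_succ (a : ℝ) (n : ℕ) :
    risingFactorial a (n + 1) = risingFactorial a n * (a + n) :=
  Finset.prod_range_succ _ _

lemma risingFactorial_succ' (a : ℝ) (n : ℕ) :
    risingFactorial a (n + 1) = a * risingFactorial (a + 1) n := by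
  unfold risingFactorial
  rw [Finset.prod_range_succ', mul_comm]
  congr 1
  · simp
  · refine Finset.prod_congr rfl fun i _ => ?_
    push_cast
    ring

lemma risingFactorial_pos {a : ℝ} (ha : 0 < a) (n : ℕ) : 0 < risingFactorial a n :=
  Finset.prod_pos fun i _ => by positivity

lemma Gamma_add_natCast {a : ℝ} (ha : 0 < a) (n : ℕ) :
    Real.Gamma (a + n) = Real.Gamma a * risingFactorial a n := by
  induction n with
  | zero => simp
  | succ n ih =>
    have : a + ((n + 1 : ℕ) : ℝ) = (a + n) + 1 := by push_cast; ring
    rw [this, Real.Gamma_add_one (by positivity), ih, risingFactorial_succ]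
    ring

lemma two_pow_mul_risingFactorial_half (p : ℕ) :
    4 ^ p * risingFactorial (1 / 2) p * (p.factorial : ℝ) = ((2 * p).factorial : ℝ) := by
  induction p with
  | zero => simp
  | succ p ih =>
    have h : 2 * (p + 1) = 2 * p + 1 + 1 := by ring
    rw [h, Nat.factorial_succ, Nat.factorial_succ, Nat.factorial_succ, risingFactorial_succ]
    push_cast
    rw [← ih]
    ring

/-- The Chu-Vandermonde identity. -/
lemma sum_choose_mul_descFactorial_div (i : ℕ) : ∀ (j : ℕ) {a : ℝ}, 0 < a →
    ∑ p ∈ Finset.range (i + 1), (i.choose p : ℝ) * (j.descFactorial p : ℝ) / risingFactorial a p =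
      risingFactorial a (i + j) / (risingFactorial a i * risingFactorial a j) := by
  induction i with
  | zero =>
    intro j a ha
    have := (risingFactorial_pos ha j).ne'
    simp [this]
  | succ i ih =>
    intro j a ha
    -- Pascal's rule for `(i + 1).choose p`. The first sum is the induction hypothesis at `(j, a)`;
    -- the second, after one factor is pulled out, is the one at `(j - 1, a + 1)`, which is why `j`
    -- and `a` vary in the induction.
    have hsplit : ∑ p ∈ Finset.range (i + 1 + 1),
        ((i + 1).choose p : ℝ) * (j.descFactorial p : ℝ) / risingFactorial a p =
        (∑ p ∈ Finset.range (i + 1), (i.choose p : ℝ) * (j.descFactorial p : ℝ)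
          / risingFactorial a p) +
        ∑ p ∈ Finset.range (i + 1), (i.choose p : ℝ) * (j.descFactorial (p + 1) : ℝ)
          / risingFactorial a (p + 1) := by
      rw [Finset.sum_range_succ' _ (i + 1)]
      have h1 : ∑ p ∈ Finset.range (i + 1), (i.choose p : ℝ) * (j.descFactorial p : ℝ)
          / risingFactorial a p = (∑ p ∈ Finset.range (i + 1), (i.choose (p + 1) : ℝ)
            * (j.descFactorial (p + 1) : ℝ) / risingFactorial a (p + 1)) + 1 := by
        rw [Finset.sum_range_succ', Finset.sum_range_succ _ i]
        simp
      rw [h1]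
      simp only [Nat.choose_succ_succ, Nat.cast_add, Nat.choose_zero_right, Nat.descFactorial_zero,
        risingFactorial_zero]
      simp only [add_mul, add_div, Finset.sum_add_distrib]
      push_cast
      ring
    rw [hsplit, ih j ha]
    have hi := risingFactorial_pos ha i
    have hj := risingFactorial_pos ha j
    have hai : 0 < a + i := by positivity
    cases j with
    | zero =>
      have : 0 < a + i := by positivity
      simp [hi.ne', (risingFactorial_pos ha (i + 1)).ne']
    | succ j =>
      have ha1 : 0 < a + 1 := by positivity
      have h2 : ∑ p ∈ Finset.range (i + 1), (i.choose p : ℝ) * ((j + 1).descFactorial (p + 1) : ℝ)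
          / risingFactorial a (p + 1) = ((j + 1 : ℕ) : ℝ) / a * ∑ p ∈ Finset.range (i + 1),
            (i.choose p : ℝ) * (j.descFactorial p : ℝ) / risingFactorial (a + 1) p := by
        rw [Finset.mul_sum]
        refine Finset.sum_congr rfl fun p _ => ?_
        have := (risingFactorial_pos ha1 p).ne'
        rw [Nat.succ_descFactorial_succ, risingFactorial_succ']
        push_cast
        field_simp
      rw [h2, ih j ha1]
      have e (m : ℕ) : risingFactorial (a + 1) m = risingFactorial a (m + 1) / a := by
        rw [risingFactorial_succ']
        field_simp
      have e1 : i + 1 + (j + 1) = (i + (j + 1)) + 1 := by ring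
      have e2 : i + j + 1 = i + (j + 1) := by ring
      rw [e, e, e, e1, risingFactorial_succ a (i + (j + 1)), risingFactorial_succ a i, e2]
      push_cast
      field_simp
      ring

/-! ### Moments of the angle law. -/

section AngleLaw

variable {s : ℝ}

lemma angleLaw_neg_half : angleLaw (-(1 / 2)) =
    (2⁻¹ : ℝ≥0∞) • Measure.dirac (-1) + (2⁻¹ : ℝ≥0∞) • Measure.dirac 1 := by
  unfold angleLaw
  rw [if_pos rfl]

lemma integral_angleLaw_neg_half (f : ℝ → ℝ) :
    ∫ u, f u ∂angleLaw (-(1 / 2)) = (f (-1) + f 1) / 2 := by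
  have h2 : (2⁻¹ : ℝ≥0∞) ≠ ∞ := by simp
  rw [angleLaw_neg_half, integral_add_measure, integral_smul_measure, integral_smul_measure,
    integral_dirac, integral_dirac]
  · simp
    ring
  · exact (integrable_dirac (by simp [enorm_lt_top])).smul_measure h2
  · exact (integrable_dirac (by simp [enorm_lt_top])).smul_measure h2

lemma integral_angleLaw (hs : -(1 / 2) < s) (f : ℝ → ℝ) :
    ∫ u, f u ∂angleLaw s = ∫ u in Ioo (-1) 1,
      Real.Gamma (s + 1) / (Real.sqrt Real.pi * Real.Gamma (s + 1 / 2))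
        * (1 - u ^ 2) ^ (s - 1 / 2) * f u := by
  unfold angleLaw
  rw [if_neg hs.ne', integral_withDensity_eq_integral_toReal_smul (by fun_prop) (by simp)]
  refine setIntegral_congr_fun measurableSet_Ioo fun u hu => ?_
  have h1 : 0 < 1 - u ^ 2 := by nlinarith [hu.1, hu.2]
  have h2 : 0 < Real.Gamma (s + 1) := Real.Gamma_pos_of_pos (by linarith)
  have h3 : 0 < Real.Gamma (s + 1 / 2) := Real.Gamma_pos_of_pos (by linarith)
  simp only [smul_eq_mul]
  rw [ENNReal.toReal_ofReal (by positivity)]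

lemma ae_angleLaw_abs_le (hs : -(1 / 2) ≤ s) : ∀ᵐ u ∂angleLaw s, |u| ≤ 1 := by
  have hm : MeasurableSet {u : ℝ | |u| ≤ 1} := measurableSet_le (by fun_prop) (by fun_prop)
  rcases hs.eq_or_lt with rfl | h
  · rw [angleLaw_neg_half, ae_add_measure_iff]
    constructor <;> refine Measure.ae_smul_measure ?_ _ <;> rw [ae_dirac_iff hm] <;> simp
  · unfold angleLaw
    rw [if_neg h.ne']
    refine (withDensity_absolutelyContinuous _ _).ae_le ?_
    filter_upwards [ae_restrict_mem measurableSet_Ioo] with u hu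
    exact abs_le.2 ⟨hu.1.le, hu.2.le⟩

lemma integrable_angleLaw (hs : -(1 / 2) ≤ s) {f : ℝ → ℝ} (hf : Continuous f) :
    Integrable f (angleLaw s) := by
  have := isProbabilityMeasure_angleLaw hs
  obtain ⟨C, hC⟩ := (isCompact_Icc (a := (-1 : ℝ)) (b := 1)).exists_bound_of_continuousOn
    hf.continuousOn
  refine Integrable.of_bound hf.aestronglyMeasurable C ?_
  filter_upwards [ae_angleLaw_abs_le hs] with u hu
  exact hC u (abs_le.1 hu)

lemma integral_angleLaw_odd (hs : -(1 / 2) ≤ s) {f : ℝ → ℝ} (hf : ∀ u, f (-u) = -f u) :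
    ∫ u, f u ∂angleLaw s = 0 := by
  rcases hs.eq_or_lt with rfl | h
  · rw [integral_angleLaw_neg_half, hf]
    ring
  · rw [integral_angleLaw h, ← integral_indicator measurableSet_Ioo]
    set g : ℝ → ℝ := indicator (Ioo (-1) 1) fun u =>
      Real.Gamma (s + 1) / (Real.sqrt Real.pi * Real.Gamma (s + 1 / 2))
        * (1 - u ^ 2) ^ (s - 1 / 2) * f u
    have h1 : ∀ u, g (-u) = -g u := by
      intro u
      simp only [g, indicator_apply, mem_Ioo, hf, neg_sq]
      have : (-1 < -u ∧ -u < 1) ↔ (-1 < u ∧ u < 1) := by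
        constructor <;> rintro ⟨h1, h2⟩ <;> constructor <;> linarith
      simp only [this]
      split_ifs <;> ring
    have h2 : ∫ u, g (-u) = ∫ u, g u := integral_neg_eq_self g volume
    simp only [h1, integral_neg] at h2
    linarith

/-- The factor `1 - u²` raises the exponent of the density by one, that is, it shifts `s` to `s +
1`; the constant is the ratio of the normalizations. At `s = -1/2` both sides vanish. -/
lemma integral_one_sub_sq_mul_angleLaw (hs : -(1 / 2) ≤ s) (f : ℝ → ℝ) :
    ∫ u, (1 - u ^ 2) * f u ∂angleLaw s =
      (s + 1 / 2) / (s + 1) * ∫ u, f u ∂angleLaw (s + 1) := by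
  rcases hs.eq_or_lt with rfl | h
  · rw [integral_angleLaw_neg_half]
    norm_num
  · rw [integral_angleLaw h, integral_angleLaw (by linarith), ← integral_const_mul]
    refine setIntegral_congr_fun measurableSet_Ioo fun u hu => ?_
    have h1 : 0 < 1 - u ^ 2 := by nlinarith [hu.1, hu.2]
    have h2 : 0 < Real.Gamma (s + 1 / 2) := Real.Gamma_pos_of_pos (by linarith)
    have h3 : 0 < Real.sqrt Real.pi := Real.sqrt_pos.mpr Real.pi_pos
    have e1 : s + 1 - 1 / 2 = (s - 1 / 2) + 1 := by ring
    have e2 : s + 1 + 1 / 2 = (s + 1 / 2) + 1 := by ring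
    have h4 : s + 1 / 2 ≠ 0 := by linarith
    have h5 : s + 1 ≠ 0 := by linarith
    rw [e1, e2, Real.Gamma_add_one h4, Real.Gamma_add_one h5, Real.rpow_add_one h1.ne']
    generalize Real.Gamma (s + 1 / 2) = A at h2 ⊢
    generalize s + 1 / 2 = b at h4 ⊢
    field_simp

/-- Induction through `u ^ (2p + 2) = u ^ (2p) - (1 - u²) u ^ (2p)`, whose last term is a moment of
the law with parameter `s + 1`; hence `s` varies with the induction. -/
lemma integral_pow_two_mul_angleLaw (p : ℕ) : ∀ {s : ℝ}, -(1 / 2) ≤ s →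
    ∫ u, u ^ (2 * p) ∂angleLaw s = risingFactorial (1 / 2) p / risingFactorial (s + 1) p := by
  induction p with
  | zero =>
    intro s hs
    have := isProbabilityMeasure_angleLaw hs
    simp
  | succ p ih =>
    intro s hs
    have h1 : ∫ u, u ^ (2 * (p + 1)) ∂angleLaw s =
        ∫ u, u ^ (2 * p) ∂angleLaw s - ∫ u, (1 - u ^ 2) * u ^ (2 * p) ∂angleLaw s := by
      rw [← integral_sub (integrable_angleLaw hs (by fun_prop))
        (integrable_angleLaw hs (by fun_prop))]
      refine integral_congr_ae (.of_forall fun u => ?_)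
      ring
    have ha : 0 < s + 1 := by linarith
    have ha' : 0 < s + 1 + 1 := by linarith
    have hr := risingFactorial_pos ha p
    have hr' := risingFactorial_pos ha' p
    have hap : 0 < s + 1 + p := by positivity
    have hrel : risingFactorial (s + 1) p * (s + 1 + p) =
        (s + 1) * risingFactorial (s + 1 + 1) p := by
      rw [← risingFactorial_succ, risingFactorial_succ']
    have hrel' : risingFactorial (s + 1 + 1) p =
        risingFactorial (s + 1) p * (s + 1 + p) / (s + 1) := by
      rw [hrel]
      field_simp
    rw [h1, integral_one_sub_sq_mul_angleLaw hs, ih hs, ih (by linarith),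
      risingFactorial_succ, risingFactorial_succ, hrel']
    field_simp
    ring

lemma integral_pow_odd_angleLaw (hs : -(1 / 2) ≤ s) {k : ℕ} (hk : Odd k) :
    ∫ u, u ^ k ∂angleLaw s = 0 :=
  integral_angleLaw_odd hs fun u => hk.neg_pow u

end AngleLaw

/-! ### The kernel `Λ_s`: series, Poisson integral, estimates. -/

section Kernel

/-- The coefficient of `z ^ (2 m)` in the power series of `Λ_s(z)`. -/
noncomputable def kernelCoeff (s : ℝ) (m : ℕ) : ℝ :=
  (-1) ^ m / ((m.factorial : ℝ) * risingFactorial (s + 1) m * 4 ^ m)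

variable {s : ℝ}

lemma kingmanKernel_eq_tsum (hs : -(1 / 2) ≤ s) (z : ℝ) :
    kingmanKernel s z = ∑' m : ℕ, kernelCoeff s m * (z ^ 2) ^ m := by
  have ha : 0 < s + 1 := by linarith
  unfold kingmanKernel kernelCoeff
  refine tsum_congr fun m => ?_
  have e : s + m + 1 = s + 1 + m := by ring
  have h1 := Real.Gamma_pos_of_pos ha
  have h2 := risingFactorial_pos ha m
  rw [e, Gamma_add_natCast ha, pow_mul, div_pow, div_pow, show ((2 : ℝ) ^ 2) = 4 by norm_num]
  field_simp

lemma abs_kernelCoeff_le (hs : -(1 / 2) ≤ s) (m : ℕ) :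
    |kernelCoeff s m| ≤ 1 / (m.factorial : ℝ) := by
  have ha : 0 < s + 1 := by linarith
  have h2 := risingFactorial_pos ha m
  -- Since `s + 1 ≥ 1/2`, each factor `4 (s + 1 + n)` is at least `2`.
  have h3 : 1 ≤ risingFactorial (s + 1) m * 4 ^ m := by
    have : ∀ n : ℕ, 1 ≤ risingFactorial (s + 1) n * 4 ^ n := by
      intro n
      induction n with
      | zero => simp
      | succ n ih =>
        rw [risingFactorial_succ, pow_succ]
        have : 1 ≤ (s + 1 + n) * 4 := by
          have : (0 : ℝ) ≤ n := by positivity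
          linarith
        nlinarith
    exact this m
  have h4 : (0 : ℝ) < m.factorial := by positivity
  unfold kernelCoeff
  rw [abs_div, abs_pow, abs_neg, abs_one, one_pow, mul_assoc, abs_of_pos (by positivity)]
  gcongr
  exact le_mul_of_one_le_right h4.le h3

lemma summable_norm_kernelCoeff (hs : -(1 / 2) ≤ s) (w : ℝ) :
    Summable fun m => ‖kernelCoeff s m * w ^ m‖ := by
  refine Summable.of_nonneg_of_le (fun _ => norm_nonneg _) (fun m => ?_)
    (Real.summable_pow_div_factorial |w|)
  rw [norm_mul, norm_pow, Real.norm_eq_abs, Real.norm_eq_abs]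
  calc |kernelCoeff s m| * |w| ^ m ≤ 1 / (m.factorial : ℝ) * |w| ^ m := by
        gcongr
        exact abs_kernelCoeff_le hs m
    _ = _ := by ring

/-- Poisson's integral representation. -/
lemma kingmanKernel_eq_integral_cos (hs : -(1 / 2) ≤ s) (z : ℝ) :
    kingmanKernel s z = ∫ u, Real.cos (z * u) ∂angleLaw s := by
  have := isProbabilityMeasure_angleLaw hs
  set F : ℕ → ℝ → ℝ := fun n u => (-1) ^ n * (z * u) ^ (2 * n) / ((2 * n).factorial : ℝ)
  have hint : ∀ n, Integrable (F n) (angleLaw s) := fun n =>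
    integrable_angleLaw hs (by fun_prop)
  have hsum : Summable fun n => ∫ u, ‖F n u‖ ∂angleLaw s := by
    refine Summable.of_nonneg_of_le (fun n => integral_nonneg fun _ => norm_nonneg _) (fun n => ?_)
      ((Real.summable_pow_div_factorial |z|).comp_injective
        (mul_right_injective₀ (two_ne_zero (α := ℕ))))
    have : ∀ᵐ u ∂angleLaw s, ‖F n u‖ ≤ |z| ^ (2 * n) / ((2 * n).factorial : ℝ) := by
      filter_upwards [ae_angleLaw_abs_le hs] with u hu
      simp only [F, norm_div, norm_mul, norm_pow, Real.norm_eq_abs, abs_neg, abs_one, one_pow,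
        one_mul, Nat.abs_cast]
      gcongr
      exact mul_le_of_le_one_right (abs_nonneg _) hu
    calc ∫ u, ‖F n u‖ ∂angleLaw s ≤ ∫ u, |z| ^ (2 * n) / ((2 * n).factorial : ℝ) ∂angleLaw s :=
          integral_mono_ae (hint n).norm (integrable_const _) this
      _ = _ := by simp
  have h := hasSum_integral_of_summable_integral_norm hint hsum
  have hcos : ∀ u, ∑' n, F n u = Real.cos (z * u) := fun u => (Real.hasSum_cos (z * u)).tsum_eq
  simp only [hcos] at h
  rw [← h.tsum_eq, kingmanKernel_eq_tsum hs]
  refine tsum_congr fun m => ?_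
  have ha : 0 < s + 1 := by linarith
  have e : ∀ u, F m u = ((-1) ^ m * z ^ (2 * m) / ((2 * m).factorial : ℝ)) * u ^ (2 * m) := by
    intro u
    simp only [F, mul_pow]
    ring
  simp only [e]
  rw [integral_const_mul, integral_pow_two_mul_angleLaw m hs, ← two_pow_mul_risingFactorial_half,
    kernelCoeff, pow_mul]
  have h1 := risingFactorial_pos ha m
  have h2 := risingFactorial_pos (show (0 : ℝ) < 1 / 2 by norm_num) m
  field_simp

lemma abs_kingmanKernel_le_one (hs : -(1 / 2) ≤ s) (z : ℝ) : |kingmanKernel s z| ≤ 1 := by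
  have := isProbabilityMeasure_angleLaw hs
  rw [kingmanKernel_eq_integral_cos hs, ← Real.norm_eq_abs]
  refine (norm_integral_le_of_norm_le_const (C := 1) (.of_forall fun u => ?_)).trans (by simp)
  exact Real.abs_cos_le_one _

lemma continuous_kingmanKernel (hs : -(1 / 2) ≤ s) : Continuous (kingmanKernel s) := by
  have := isProbabilityMeasure_angleLaw hs
  have h : kingmanKernel s = fun z => ∫ u, Real.cos (z * u) ∂angleLaw s :=
    funext (kingmanKernel_eq_integral_cos hs)
  rw [h]
  refine continuous_of_dominated (bound := fun _ => 1) (fun z => ?_) (fun z => ?_)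
    (integrable_const _) (.of_forall fun u => by fun_prop)
  · exact Continuous.aestronglyMeasurable (by fun_prop)
  · exact .of_forall fun u => Real.abs_cos_le_one _

lemma one_sub_kingmanKernel (hs : -(1 / 2) ≤ s) (z : ℝ) :
    1 - kingmanKernel s z = ∫ u, (1 - Real.cos (z * u)) ∂angleLaw s := by
  have := isProbabilityMeasure_angleLaw hs
  rw [integral_sub (integrable_const _) (integrable_angleLaw hs (by fun_prop)),
    kingmanKernel_eq_integral_cos hs]
  simp

/-- `1 - cos 2θ = 2 (1 - cos θ) (1 + cos θ) ≤ 4 (1 - cos θ)`, integrated over the angle. This lets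
smallness near the origin control the transform at every `t` with quadratic growth. -/
lemma one_sub_kingmanKernel_two_mul_le (hs : -(1 / 2) ≤ s) (z : ℝ) :
    1 - kingmanKernel s (2 * z) ≤ 4 * (1 - kingmanKernel s z) := by
  rw [one_sub_kingmanKernel hs, one_sub_kingmanKernel hs, ← integral_const_mul]
  refine integral_mono (integrable_angleLaw hs (by fun_prop))
    (integrable_angleLaw hs (by fun_prop)) fun u => ?_
  have h1 := Real.cos_two_mul (z * u)
  simp only [mul_assoc] at h1 ⊢
  rw [h1]
  nlinarith [sq_nonneg (Real.cos (z * u) - 1)]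

lemma one_sub_kingmanKernel_two_pow_mul_le (hs : -(1 / 2) ≤ s) (p : ℕ) (z : ℝ) :
    1 - kingmanKernel s (2 ^ p * z) ≤ 4 ^ p * (1 - kingmanKernel s z) := by
  induction p with
  | zero => simp
  | succ p ih =>
    have h := one_sub_kingmanKernel_two_mul_le hs (2 ^ p * z)
    rw [pow_succ' 2, pow_succ' 4, mul_assoc, mul_assoc]
    linarith

lemma integral_sq_angleLaw (hs : -(1 / 2) ≤ s) :
    ∫ u, u ^ 2 ∂angleLaw s = 1 / (2 * (s + 1)) := by
  have h := integral_pow_two_mul_angleLaw 1 hs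
  rw [mul_one] at h
  rw [h]
  simp [risingFactorial]
  ring

lemma one_sub_kingmanKernel_le (hs : -(1 / 2) ≤ s) (z : ℝ) :
    1 - kingmanKernel s z ≤ z ^ 2 / (4 * (s + 1)) := by
  have ha : 0 < s + 1 := by linarith
  rw [one_sub_kingmanKernel hs]
  calc ∫ u, (1 - Real.cos (z * u)) ∂angleLaw s ≤ ∫ u, z ^ 2 / 2 * u ^ 2 ∂angleLaw s := by
        refine integral_mono (integrable_angleLaw hs (by fun_prop))
          (integrable_angleLaw hs (by fun_prop)) fun u => ?_
        have := Real.one_sub_sq_div_two_le_cos (x := z * u)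
        simp only [mul_pow] at this ⊢
        linarith
    _ = _ := by
        rw [integral_const_mul, integral_sq_angleLaw hs]
        field_simp
        ring

/-- The fourth-order Taylor bound for the cosine, integrated; the quadratic coefficient comes from
the second moment `1 / (2 (s + 1))` of the angle law. -/
lemma abs_kingmanKernel_sub_le (hs : -(1 / 2) ≤ s) {z : ℝ} (hz : |z| ≤ 1) :
    |kingmanKernel s z - (1 - z ^ 2 / (4 * (s + 1)))| ≤ z ^ 4 := by
  have := isProbabilityMeasure_angleLaw hs
  have ha : 0 < s + 1 := by linarith
  have h1 : kingmanKernel s z - (1 - z ^ 2 / (4 * (s + 1))) =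
      ∫ u, (Real.cos (z * u) - (1 - z ^ 2 / 2 * u ^ 2)) ∂angleLaw s := by
    rw [integral_sub (integrable_angleLaw hs (by fun_prop)) (integrable_angleLaw hs (by fun_prop)),
      integral_sub (integrable_const _) (integrable_angleLaw hs (by fun_prop)),
      integral_const_mul, integral_sq_angleLaw hs, kingmanKernel_eq_integral_cos hs]
    simp
    field_simp
    ring
  rw [h1, ← Real.norm_eq_abs]
  refine (norm_integral_le_of_norm_le_const (C := z ^ 4) ?_).trans (by simp)
  filter_upwards [ae_angleLaw_abs_le hs] with u hu
  have h2 : |z * u| ≤ |z| := by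
    rw [abs_mul]
    exact mul_le_of_le_one_right (abs_nonneg _) hu
  have h3 := Real.cos_bound (h2.trans hz)
  have h4 : z ^ 2 / 2 * u ^ 2 = (z * u) ^ 2 / 2 := by ring
  rw [Real.norm_eq_abs, h4]
  have h5 : |z * u| ^ 4 ≤ z ^ 4 := by
    rw [← Even.pow_abs (by decide : Even 4) z]
    gcongr
  have h6 : 0 ≤ z ^ 4 := by positivity
  linarith

/-! ### The product formula. -/

/-- The even moments of the third side of a triangle with random angle. -/
lemma integral_lawOfCosines_pow (hs : -(1 / 2) ≤ s) (x y : ℝ) (n : ℕ) :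
    ∫ u, (x ^ 2 + 2 * u * x * y + y ^ 2) ^ n ∂angleLaw s =
      ∑ ij ∈ Finset.HasAntidiagonal.antidiagonal n, (n.factorial : ℝ) * risingFactorial (s + 1) n /
        (ij.1.factorial * ij.2.factorial * risingFactorial (s + 1) ij.1
          * risingFactorial (s + 1) ij.2) * ((x ^ 2) ^ ij.1 * (y ^ 2) ^ ij.2) := by
  have ha : 0 < s + 1 := by linarith
  set m : ℕ → ℝ := fun k => ∫ u, u ^ k ∂angleLaw s with hm
  -- Two binomial expansions: first in powers `k` of the cross term `2xyu`, then of `x² + y²` with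
  -- exponents `(α, β)`.
  have hL : ∫ u, (x ^ 2 + 2 * u * x * y + y ^ 2) ^ n ∂angleLaw s =
      ∑ q ∈ (Finset.range (n + 1)).sigma fun k => Finset.HasAntidiagonal.antidiagonal (n - k),
        ((2 * x * y) ^ q.1 * m q.1 * n.choose q.1) *
          ((x ^ 2) ^ q.2.1 * (y ^ 2) ^ q.2.2 * ((n - q.1).choose q.2.1)) := by
    have h1 : ∀ u : ℝ, (x ^ 2 + 2 * u * x * y + y ^ 2) ^ n =
        ∑ q ∈ (Finset.range (n + 1)).sigma fun k => Finset.HasAntidiagonal.antidiagonal (n - k),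
        ((2 * x * y) ^ q.1 * n.choose q.1) *
          ((x ^ 2) ^ q.2.1 * (y ^ 2) ^ q.2.2 * ((n - q.1).choose q.2.1)) * u ^ q.1 := by
      intro u
      have e : x ^ 2 + 2 * u * x * y + y ^ 2 = 2 * x * y * u + (x ^ 2 + y ^ 2) := by ring
      rw [e, add_pow, Finset.sum_sigma]
      refine Finset.sum_congr rfl fun k _ => ?_
      rw [(Commute.all (x ^ 2) (y ^ 2)).add_pow', Finset.mul_sum, Finset.sum_mul]
      refine Finset.sum_congr rfl fun ij _ => ?_
      simp only [nsmul_eq_mul, mul_pow]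
      ring
    simp only [h1]
    rw [integral_finsetSum _ fun q _ => integrable_angleLaw hs (by fun_prop)]
    refine Finset.sum_congr rfl fun q _ => ?_
    rw [integral_const_mul]
    ring
  -- Chu-Vandermonde read backwards opens each coefficient into a sum over `p`, to be matched with
  -- the cross terms of even order `k = 2p`.
  have hR : ∑ ij ∈ Finset.HasAntidiagonal.antidiagonal n, (n.factorial : ℝ) * risingFactorial (s + 1) n /
        (ij.1.factorial * ij.2.factorial * risingFactorial (s + 1) ij.1
          * risingFactorial (s + 1) ij.2) * ((x ^ 2) ^ ij.1 * (y ^ 2) ^ ij.2) =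
      ∑ q ∈ (Finset.HasAntidiagonal.antidiagonal n).sigma fun ij => Finset.range (ij.1 + 1),
        (n.factorial : ℝ) / (q.1.1.factorial * q.1.2.factorial) * ((q.1.1.choose q.2 : ℝ)
          * (q.1.2.descFactorial q.2 : ℝ) / risingFactorial (s + 1) q.2)
          * ((x ^ 2) ^ q.1.1 * (y ^ 2) ^ q.1.2) := by
    rw [Finset.sum_sigma]
    refine Finset.sum_congr rfl fun ij hij => ?_
    simp only
    rw [← Finset.sum_mul, ← Finset.mul_sum, sum_choose_mul_descFactorial_div _ _ ha,
      Finset.HasAntidiagonal.mem_antidiagonal.1 hij]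
    have h1 := (risingFactorial_pos ha ij.1).ne'
    have h2 := (risingFactorial_pos ha ij.2).ne'
    field_simp
  rw [hL, hR]
  -- Odd moments kill the terms with odd `k` on the left, and the descending factorial those with `p
  -- > j` on the right. What remains is matched by `k = 2p`, `i = p + α`, `j = p + β`.
  rw [← Finset.sum_filter_of_ne (p := fun q => Even q.1), ← Finset.sum_filter_of_ne
    (p := fun q : (_ : ℕ × ℕ) × ℕ => q.2 ≤ q.1.2)]
  · refine Finset.sum_bij' (fun q _ => ⟨(q.1 / 2 + q.2.1, q.1 / 2 + q.2.2), q.1 / 2⟩)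
      (fun q _ => ⟨2 * q.2, (q.1.1 - q.2, q.1.2 - q.2)⟩) ?_ ?_ ?_ ?_ ?_
    · rintro ⟨k, α, β⟩ hq
      simp only [Finset.mem_filter, Finset.mem_sigma, Finset.mem_range,
        Finset.HasAntidiagonal.mem_antidiagonal, Nat.even_iff] at hq ⊢
      omega
    · rintro ⟨⟨i, j⟩, p⟩ hq
      simp only [Finset.mem_filter, Finset.mem_sigma, Finset.mem_range,
        Finset.HasAntidiagonal.mem_antidiagonal, Nat.even_iff] at hq ⊢
      omega
    · rintro ⟨k, α, β⟩ hq
      simp only [Finset.mem_filter, Finset.mem_sigma, Finset.mem_range,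
        Finset.HasAntidiagonal.mem_antidiagonal, Nat.even_iff] at hq
      simp only [Sigma.mk.injEq, Prod.mk.injEq, heq_eq_eq]
      omega
    · rintro ⟨⟨i, j⟩, p⟩ hq
      simp only [Finset.mem_filter, Finset.mem_sigma, Finset.mem_range,
        Finset.HasAntidiagonal.mem_antidiagonal] at hq
      simp only [Sigma.mk.injEq, Prod.mk.injEq, heq_eq_eq]
      omega
    · rintro ⟨k, α, β⟩ hq
      simp only [Finset.mem_filter, Finset.mem_sigma, Finset.mem_range,
        Finset.HasAntidiagonal.mem_antidiagonal] at hq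
      obtain ⟨⟨hk, hαβ⟩, hev⟩ := hq
      obtain ⟨p, rfl⟩ := even_iff_two_dvd.1 hev
      have e1 : 2 * p / 2 = p := by omega
      have e2 : n = 2 * p + (α + β) := by omega
      have e3 : n - 2 * p = α + β := by omega
      have hmp : m (2 * p) = risingFactorial (1 / 2) p / risingFactorial (s + 1) p :=
        integral_pow_two_mul_angleLaw p hs
      simp only [e1, e3, hmp]
      rw [e2, Nat.cast_add_choose, Nat.cast_add_choose, Nat.cast_add_choose]
      have h3 : ((p + β).descFactorial p : ℝ) * (β.factorial : ℝ) = ((p + β).factorial : ℝ) := by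
        have := Nat.factorial_mul_descFactorial (Nat.le_add_right p β)
        rw [Nat.add_sub_cancel_left] at this
        rw [← this]
        push_cast
        ring
      have h4 := two_pow_mul_risingFactorial_half p
      have h5 := risingFactorial_pos ha p
      have h6 := risingFactorial_pos (show (0 : ℝ) < 1 / 2 by norm_num) p
      have h7 : ((p + β).descFactorial p : ℝ) = ((p + β).factorial : ℝ) / (β.factorial : ℝ) := by
        rw [← h3]
        field_simp
      rw [h7, ← h4]
      have e5 : (2 * x * y) ^ (2 * p) = 4 ^ p * (x ^ 2) ^ p * (y ^ 2) ^ p := by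
        rw [pow_mul, mul_pow, mul_pow, mul_pow, mul_pow]
        norm_num
      rw [e5, pow_add, pow_add]
      field_simp
  · rintro ⟨⟨i, j⟩, p⟩ hq hne
    by_contra hpj
    simp [Nat.descFactorial_eq_zero_iff_lt.2 (not_le.1 hpj)] at hne
  · rintro ⟨k, α, β⟩ hq hne
    by_contra hk
    simp [hm, integral_pow_odd_angleLaw hs (Nat.not_even_iff_odd.1 hk)] at hne

lemma measurable_lawOfCosines (x y : ℝ≥0) : Measurable (lawOfCosines x y) := by
  unfold lawOfCosines
  fun_prop

lemma coe_lawOfCosines_sq (x y : ℝ≥0) {u : ℝ} (hu : |u| ≤ 1) :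
    (lawOfCosines x y u : ℝ) ^ 2 = (x : ℝ) ^ 2 + 2 * u * x * y + (y : ℝ) ^ 2 := by
  have h : 0 ≤ (x : ℝ) ^ 2 + 2 * u * x * y + (y : ℝ) ^ 2 := by
    have h1 : 0 ≤ (x : ℝ) * y := by positivity
    have := abs_le.1 hu
    nlinarith [sq_nonneg ((x : ℝ) - y)]
  unfold lawOfCosines
  rw [Real.coe_sqrt, Real.sq_sqrt (NNReal.coe_nonneg _), Real.coe_toNNReal _ h]

lemma isProbabilityMeasure_kingmanDirac (hs : -(1 / 2) ≤ s) (x y : ℝ≥0) :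
    IsProbabilityMeasure (kingmanDirac s x y) :=
  have := isProbabilityMeasure_angleLaw hs
  Measure.isProbabilityMeasure_map (measurable_lawOfCosines x y).aemeasurable

/-- The product formula for `Λ_s`. -/
lemma integral_kingmanKernel_kingmanDirac (hs : -(1 / 2) ≤ s) (t x y : ℝ≥0) :
    ∫ z, kingmanKernel s (t * z) ∂kingmanDirac s x y =
      kingmanKernel s (t * x) * kingmanKernel s (t * y) := by
  have := isProbabilityMeasure_angleLaw hs
  have ha : 0 < s + 1 := by linarith
  unfold kingmanDirac
  rw [integral_map (measurable_lawOfCosines x y).aemeasurable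
    (Continuous.aestronglyMeasurable (f := fun z : ℝ≥0 => kingmanKernel s (t * z))
      ((continuous_kingmanKernel hs).comp (by fun_prop)))]
  set q : ℝ → ℝ := fun u => (x : ℝ) ^ 2 + 2 * u * x * y + (y : ℝ) ^ 2 with hq
  set F : ℕ → ℝ → ℝ := fun n u => kernelCoeff s n * ((t : ℝ) ^ 2) ^ n * q u ^ n
  have hint : ∀ n, Integrable (F n) (angleLaw s) := fun n =>
    integrable_angleLaw hs (by fun_prop)
  have hsum : Summable fun n => ∫ u, ‖F n u‖ ∂angleLaw s := by
    refine Summable.of_nonneg_of_le (fun n => integral_nonneg fun _ => norm_nonneg _) (fun n => ?_)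
      (summable_norm_kernelCoeff hs ((t : ℝ) ^ 2 * ((x : ℝ) + y) ^ 2))
    have : ∀ᵐ u ∂angleLaw s,
        ‖F n u‖ ≤ ‖kernelCoeff s n * ((t : ℝ) ^ 2 * ((x : ℝ) + y) ^ 2) ^ n‖ := by
      filter_upwards [ae_angleLaw_abs_le hs] with u hu
      have hxy : 0 ≤ (x : ℝ) * y := by positivity
      have hu' := abs_le.1 hu
      have h1 : ‖q u‖ ≤ ‖((x : ℝ) + y) ^ 2‖ := by
        rw [Real.norm_eq_abs, Real.norm_eq_abs, abs_of_nonneg (sq_nonneg ((x : ℝ) + y)), abs_le]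
        constructor <;> simp only [hq] <;> nlinarith [sq_nonneg (x : ℝ), sq_nonneg (y : ℝ)]
      simp only [F, norm_mul, norm_pow, mul_pow, mul_assoc] at h1 ⊢
      gcongr
    calc ∫ u, ‖F n u‖ ∂angleLaw s
        ≤ ∫ u, ‖kernelCoeff s n * ((t : ℝ) ^ 2 * ((x : ℝ) + y) ^ 2) ^ n‖ ∂angleLaw s :=
          integral_mono_ae (hint n).norm (integrable_const _) this
      _ = _ := by simp
  have h := hasSum_integral_of_summable_integral_norm hint hsum
  have hF : ∫ u, kingmanKernel s (t * lawOfCosines x y u) ∂angleLaw s =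
      ∫ u, ∑' n, F n u ∂angleLaw s := by
    refine integral_congr_ae ?_
    filter_upwards [ae_angleLaw_abs_le hs] with u hu
    rw [kingmanKernel_eq_tsum hs]
    refine tsum_congr fun n => ?_
    simp only [F]
    rw [mul_pow, coe_lawOfCosines_sq x y hu, mul_pow]
    ring
  -- Both sides are power series in `t²`; the moments of the squared third side are exactly the
  -- coefficients of the Cauchy product.
  rw [hF, ← h.tsum_eq, kingmanKernel_eq_tsum hs, kingmanKernel_eq_tsum hs,
    tsum_mul_tsum_eq_tsum_sum_antidiagonal_of_summable_norm (summable_norm_kernelCoeff hs _)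
      (summable_norm_kernelCoeff hs _)]
  refine tsum_congr fun n => ?_
  simp only [F]
  rw [integral_const_mul, integral_lawOfCosines_pow hs, Finset.mul_sum]
  refine Finset.sum_congr rfl fun ij hij => ?_
  rw [← Finset.HasAntidiagonal.mem_antidiagonal.1 hij]
  have h1 := risingFactorial_pos ha ij.1
  have h2 := risingFactorial_pos ha ij.2
  have h3 := risingFactorial_pos ha (ij.1 + ij.2)
  unfold kernelCoeff
  simp only [mul_pow, pow_add]
  field_simp

end Kernel

/-! ### The Rayleigh law and its transform. -/

section Rayleigh

variable {s : ℝ}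

lemma integral_rayleighLaw (hs : -(1 / 2) ≤ s) {f : ℝ≥0 → ℝ} (hf : Measurable f) :
    ∫ y, f y ∂rayleighLaw s = ∫ y in Ioi (0 : ℝ), 2 * (s + 1) ^ (s + 1) / Real.Gamma (s + 1)
      * y ^ (2 * s + 1) * Real.exp (-(s + 1) * y ^ 2) * f y.toNNReal := by
  have ha : 0 < s + 1 := by linarith
  have hG := Real.Gamma_pos_of_pos ha
  unfold rayleighLaw
  rw [integral_map measurable_real_toNNReal.aemeasurable hf.aestronglyMeasurable,
    integral_withDensity_eq_integral_toReal_smul (by fun_prop) (by simp)]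
  refine setIntegral_congr_fun measurableSet_Ioi fun y hy => ?_
  have hy : 0 < y := hy
  simp only [smul_eq_mul]
  rw [ENNReal.toReal_ofReal (by positivity)]

lemma integrable_rayleighLaw_iff (hs : -(1 / 2) ≤ s) {f : ℝ≥0 → ℝ} (hf : Measurable f) :
    Integrable f (rayleighLaw s) ↔ IntegrableOn (fun y => 2 * (s + 1) ^ (s + 1)
      / Real.Gamma (s + 1) * y ^ (2 * s + 1) * Real.exp (-(s + 1) * y ^ 2) * f y.toNNReal)
      (Ioi (0 : ℝ)) := by
  have ha : 0 < s + 1 := by linarith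
  have hG := Real.Gamma_pos_of_pos ha
  unfold rayleighLaw
  rw [integrable_map_measure hf.aestronglyMeasurable measurable_real_toNNReal.aemeasurable,
    integrable_withDensity_iff_integrable_smul' (by fun_prop) (by simp)]
  refine integrableOn_congr_fun (fun y hy => ?_) measurableSet_Ioi
  have hy : 0 < y := hy
  simp only [smul_eq_mul, Function.comp_apply]
  rw [ENNReal.toReal_ofReal (by positivity)]

lemma integrable_pow_rayleighLaw (hs : -(1 / 2) ≤ s) (m : ℕ) :
    Integrable (fun y : ℝ≥0 => (y : ℝ) ^ (2 * m)) (rayleighLaw s) := by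
  have ha : 0 < s + 1 := by linarith
  rw [integrable_rayleighLaw_iff hs (by fun_prop)]
  have h := (integrableOn_rpow_mul_exp_neg_mul_rpow (p := 2) (s := 2 * s + 1 + 2 * m) (b := s + 1)
    (by have : (0 : ℝ) ≤ m := by positivity
        linarith) (by norm_num) ha).const_mul (2 * (s + 1) ^ (s + 1) / Real.Gamma (s + 1))
  refine (integrableOn_congr_fun (fun y hy => ?_) measurableSet_Ioi).1 h
  have hy : 0 < y := hy
  rw [Real.coe_toNNReal _ hy.le, Real.rpow_add hy (2 * s + 1), ← Real.rpow_natCast y (2 * m), Real.rpow_ofNat]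
  push_cast
  ring

lemma integral_pow_rayleighLaw (hs : -(1 / 2) ≤ s) (m : ℕ) :
    ∫ y : ℝ≥0, (y : ℝ) ^ (2 * m) ∂rayleighLaw s = risingFactorial (s + 1) m / (s + 1) ^ m := by
  have ha : 0 < s + 1 := by linarith
  have hG := Real.Gamma_pos_of_pos ha
  rw [integral_rayleighLaw hs (by fun_prop)]
  have h := integral_rpow_mul_exp_neg_mul_rpow (p := 2) (q := 2 * s + 1 + 2 * m) (b := s + 1)
    (by norm_num) (by have : (0 : ℝ) ≤ m := by positivity
                      linarith) ha
  have h1 : ∀ y ∈ Ioi (0 : ℝ), 2 * (s + 1) ^ (s + 1) / Real.Gamma (s + 1)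
      * y ^ (2 * s + 1) * Real.exp (-(s + 1) * y ^ 2) * (y.toNNReal : ℝ) ^ (2 * m) =
      2 * (s + 1) ^ (s + 1) / Real.Gamma (s + 1) *
        (y ^ (2 * s + 1 + 2 * (m : ℝ)) * Real.exp (-(s + 1) * y ^ (2 : ℝ))) := by
    intro y hy
    have hy : 0 < y := hy
    rw [Real.coe_toNNReal _ hy.le, Real.rpow_add hy (2 * s + 1), ← Real.rpow_natCast y (2 * m),
      Real.rpow_ofNat]
    push_cast
    ring
  rw [setIntegral_congr_fun measurableSet_Ioi h1, integral_const_mul, h]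
  have e1 : (2 * s + 1 + 2 * (m : ℝ) + 1) / 2 = s + 1 + m := by ring
  have e2 : -(2 * s + 1 + 2 * (m : ℝ) + 1) / 2 = -(s + 1 + m) := by ring
  rw [e1, e2, Gamma_add_natCast ha, Real.rpow_neg ha.le, Real.rpow_add ha (s + 1) m, Real.rpow_natCast]
  have h2 : 0 < (s + 1) ^ (s + 1) := Real.rpow_pos_of_pos ha _
  generalize (s + 1) ^ (s + 1) = A at h2 ⊢
  field_simp

lemma isProbabilityMeasure_rayleighLaw (hs : -(1 / 2) ≤ s) :
    IsProbabilityMeasure (rayleighLaw s) := by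
  have h1 := integrable_pow_rayleighLaw hs 0
  have h2 := integral_pow_rayleighLaw hs 0
  simp only [mul_zero, pow_zero, risingFactorial_zero, div_one] at h1 h2
  have : IsFiniteMeasure (rayleighLaw s) :=
    (integrable_const_iff_isFiniteMeasure one_ne_zero).1 h1
  rw [integral_const, smul_eq_mul, mul_one] at h2
  exact ⟨(ENNReal.toReal_eq_one_iff _).1 h2⟩

/-- The radial characteristic function of `σ_s`. -/
lemma integral_kingmanKernel_rayleighLaw (hs : -(1 / 2) ≤ s) (t : ℝ) :
    ∫ y : ℝ≥0, kingmanKernel s (t * y) ∂rayleighLaw s = Real.exp (-(t ^ 2 / (4 * (s + 1)))) := by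
  have ha : 0 < s + 1 := by linarith
  set F : ℕ → ℝ≥0 → ℝ := fun n y => kernelCoeff s n * (t ^ 2) ^ n * (y : ℝ) ^ (2 * n)
  have hint : ∀ n, Integrable (F n) (rayleighLaw s) := fun n =>
    (integrable_pow_rayleighLaw hs n).const_mul _
  -- The rising factorial in the moment cancels the one in the kernel coefficient, so only the
  -- exponential series is left.
  have hval : ∀ n, kernelCoeff s n * (t ^ 2) ^ n * (risingFactorial (s + 1) n / (s + 1) ^ n) =
      (-(t ^ 2 / (4 * (s + 1)))) ^ n / (n.factorial : ℝ) := by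
    intro n
    have h1 := risingFactorial_pos ha n
    rw [neg_pow, div_pow, mul_pow]
    unfold kernelCoeff
    field_simp
  have hsum : Summable fun n => ∫ y, ‖F n y‖ ∂rayleighLaw s := by
    refine (Real.summable_pow_div_factorial (-(t ^ 2 / (4 * (s + 1))))).norm.congr fun n => ?_
    have : ∀ y, ‖F n y‖ = ‖kernelCoeff s n * (t ^ 2) ^ n‖ * (y : ℝ) ^ (2 * n) := by
      intro y
      simp only [F]
      rw [norm_mul, Real.norm_of_nonneg (by positivity : 0 ≤ (y : ℝ) ^ (2 * n))]
    have h1 := risingFactorial_pos ha n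
    simp only [this]
    rw [integral_const_mul, integral_pow_rayleighLaw hs, ← hval n, norm_mul _ (_ / _),
      Real.norm_of_nonneg (by positivity : 0 ≤ risingFactorial (s + 1) n / (s + 1) ^ n)]
  have h := hasSum_integral_of_summable_integral_norm hint hsum
  have hF : ∀ y : ℝ≥0, ∑' n, F n y = kingmanKernel s (t * y) := by
    intro y
    rw [kingmanKernel_eq_tsum hs]
    refine tsum_congr fun n => ?_
    simp only [F]
    rw [mul_pow, mul_pow, pow_mul]
    ring
  simp only [hF] at h
  rw [← h.tsum_eq, Real.exp_eq_exp_ℝ, NormedSpace.exp_eq_tsum_div]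
  refine tsum_congr fun n => ?_
  simp only [F]
  rw [integral_const_mul, integral_pow_rayleighLaw hs, hval]

end Rayleigh

/-! ### Product kernels on the cone and the radial characteristic function. -/

section Cone

variable {k : ℕ} {s : ℝ}

/-- This symmetry lets a law on the cone be used to average over `t`, with the transform of that law
as the result. -/
lemma kingmanKernelPi_comm (s : ℝ) (t x : Fin k → ℝ≥0) :
    kingmanKernelPi s t x = kingmanKernelPi s x t := by
  simp only [kingmanKernelPi, mul_comm]

lemma kingmanKernelPi_zero_right (hs : -(1 / 2) ≤ s) (t : Fin k → ℝ≥0) :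
    kingmanKernelPi s t 0 = 1 := by
  simp [kingmanKernelPi, kingmanKernel_zero hs]

lemma kingmanKernelPi_zero_left (hs : -(1 / 2) ≤ s) (x : Fin k → ℝ≥0) :
    kingmanKernelPi s 0 x = 1 := by
  rw [kingmanKernelPi_comm, kingmanKernelPi_zero_right hs]

lemma kingmanKernelPi_single (hs : -(1 / 2) ≤ s) (j : Fin k) (r : ℝ≥0) (x : Fin k → ℝ≥0) :
    kingmanKernelPi s (Pi.single j r) x = kingmanKernel s (r * x j) := by
  unfold kingmanKernelPi
  rw [Finset.prod_eq_single j]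
  · simp
  · intro i _ hi
    simp [hi, kingmanKernel_zero hs]
  · simp

lemma continuous_kingmanKernelPi₂ (hs : -(1 / 2) ≤ s) :
    Continuous fun p : (Fin k → ℝ≥0) × (Fin k → ℝ≥0) => kingmanKernelPi s p.1 p.2 := by
  unfold kingmanKernelPi
  exact continuous_finsetProd _ fun j _ => (continuous_kingmanKernel hs).comp (by fun_prop)

lemma continuous_kingmanKernelPi (hs : -(1 / 2) ≤ s) (t : Fin k → ℝ≥0) :
    Continuous (kingmanKernelPi s t) :=
  (continuous_kingmanKernelPi₂ hs).comp (by fun_prop : Continuous fun x => (t, x))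

lemma abs_kingmanKernelPi_le_one (hs : -(1 / 2) ≤ s) (t x : Fin k → ℝ≥0) :
    |kingmanKernelPi s t x| ≤ 1 := by
  unfold kingmanKernelPi
  rw [Finset.abs_prod]
  exact Finset.prod_le_one (fun _ _ => abs_nonneg _) fun _ _ => abs_kingmanKernel_le_one hs _

lemma one_sub_kingmanKernelPi_nonneg (hs : -(1 / 2) ≤ s) (t x : Fin k → ℝ≥0) :
    0 ≤ 1 - kingmanKernelPi s t x :=
  sub_nonneg.2 (abs_le.1 (abs_kingmanKernelPi_le_one hs t x)).2

/-- For two factors the inequality is `(1 - a) (1 - b) ≥ 0`. Only `|f i| ≤ 1` is required, since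
kernels may be negative. -/
lemma one_sub_prod_le_sum {ι : Type*} (S : Finset ι) (f : ι → ℝ) (hf : ∀ i, |f i| ≤ 1) :
    1 - ∏ i ∈ S, f i ≤ ∑ i ∈ S, (1 - f i) := by
  classical
  induction S using Finset.induction_on with
  | empty => simp
  | insert a S ha ih =>
    rw [Finset.prod_insert ha, Finset.sum_insert ha]
    have h1 := abs_le.1 (hf a)
    have h2 : |∏ i ∈ S, f i| ≤ 1 := by
      rw [Finset.abs_prod]
      exact Finset.prod_le_one (fun _ _ => abs_nonneg _) fun i _ => hf i
    have h3 := abs_le.1 h2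
    nlinarith

lemma one_sub_kingmanKernelPi_le_sum (hs : -(1 / 2) ≤ s) (t x : Fin k → ℝ≥0) :
    1 - kingmanKernelPi s t x ≤ ∑ j, (1 - kingmanKernel s (t j * x j)) :=
  one_sub_prod_le_sum _ _ fun _ => abs_kingmanKernel_le_one hs _

lemma integrable_kingmanKernelPi (hs : -(1 / 2) ≤ s) (N : Measure (Fin k → ℝ≥0))
    [IsFiniteMeasure N] (t : Fin k → ℝ≥0) : Integrable (kingmanKernelPi s t) N :=
  Integrable.of_bound (continuous_kingmanKernelPi hs t).aestronglyMeasurable 1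
    (.of_forall fun x => abs_kingmanKernelPi_le_one hs t x)

lemma integral_one_sub_kingmanKernelPi (hs : -(1 / 2) ≤ s) (N : Measure (Fin k → ℝ≥0))
    [IsFiniteMeasure N] (t : Fin k → ℝ≥0) :
    ∫ x, (1 - kingmanKernelPi s t x) ∂N = N.real univ - radCharFun s N t := by
  rw [integral_sub (integrable_const _) (integrable_kingmanKernelPi hs N t)]
  simp [radCharFun]

lemma radCharFun_zero (hs : -(1 / 2) ≤ s) (N : Measure (Fin k → ℝ≥0)) :
    radCharFun s N 0 = N.real univ := by
  unfold radCharFun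
  simp [kingmanKernelPi_zero_left hs]

lemma continuous_radCharFun (hs : -(1 / 2) ≤ s) (N : Measure (Fin k → ℝ≥0))
    [IsFiniteMeasure N] : Continuous (radCharFun s N) := by
  unfold radCharFun
  refine continuous_of_dominated (bound := fun _ => 1) (fun t => ?_) (fun t => ?_)
    (integrable_const _) (.of_forall fun x => ?_)
  · exact (continuous_kingmanKernelPi hs t).aestronglyMeasurable
  · exact .of_forall fun x => abs_kingmanKernelPi_le_one hs t x
  · exact (continuous_kingmanKernelPi₂ hs).comp (by fun_prop : Continuous fun t => (t, x))

/-! ### Convolution -/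

lemma isProbabilityMeasure_kingmanDiracPi (hs : -(1 / 2) ≤ s) (x y : Fin k → ℝ≥0) :
    IsProbabilityMeasure (kingmanDiracPi s x y) :=
  have := fun j => isProbabilityMeasure_kingmanDirac hs (x j) (y j)
  inferInstanceAs (IsProbabilityMeasure (Measure.pi fun j => kingmanDirac s (x j) (y j)))

lemma radCharFun_kingmanDiracPi (hs : -(1 / 2) ≤ s) (t x y : Fin k → ℝ≥0) :
    radCharFun s (kingmanDiracPi s x y) t = kingmanKernelPi s t x * kingmanKernelPi s t y := by
  have := fun j => isProbabilityMeasure_kingmanDirac hs (x j) (y j)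
  unfold radCharFun kingmanDiracPi kingmanKernelPi
  rw [integral_fintype_prod_eq_prod (fun j (z : ℝ≥0) => kingmanKernel s (t j * z)),
    ← Finset.prod_mul_distrib]
  exact Finset.prod_congr rfl fun j _ => integral_kingmanKernel_kingmanDirac hs _ _ _

lemma kingmanConv_univ (hs : -(1 / 2) ≤ s) (G₁ G₂ : Measure (Fin k → ℝ≥0)) [SFinite G₁]
    [SFinite G₂] : kingmanConv s G₁ G₂ univ = G₁ univ * G₂ univ := by
  have := fun x y : Fin k → ℝ≥0 => isProbabilityMeasure_kingmanDiracPi hs x y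
  unfold kingmanConv
  rw [Measure.bind_apply MeasurableSet.univ (measurable_kingmanDiracPi hs).aemeasurable]
  simp [← Measure.prod_prod]

lemma isFiniteMeasure_kingmanConv (hs : -(1 / 2) ≤ s) (G₁ G₂ : Measure (Fin k → ℝ≥0))
    [IsFiniteMeasure G₁] [IsFiniteMeasure G₂] : IsFiniteMeasure (kingmanConv s G₁ G₂) := by
  constructor
  rw [kingmanConv_univ hs]
  exact ENNReal.mul_lt_top (measure_lt_top _ _) (measure_lt_top _ _)

lemma isProbabilityMeasure_kingmanConv (hs : -(1 / 2) ≤ s) (G₁ G₂ : Measure (Fin k → ℝ≥0))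
    [IsProbabilityMeasure G₁] [IsProbabilityMeasure G₂] :
    IsProbabilityMeasure (kingmanConv s G₁ G₂) := by
  constructor
  simp [kingmanConv_univ hs]

/-- The mixture is the second marginal of the composition product of `m` with the kernel, to which
Fubini applies. -/
lemma integral_bind_of_integrable {α β : Type*} [MeasurableSpace α] [MeasurableSpace β]
    {m : Measure α} [SFinite m] {κ : α → Measure β} (hκ : Measurable κ)
    [∀ a, IsProbabilityMeasure (κ a)] {f : β → ℝ} (hf : Integrable f (m.bind κ)) :
    ∫ y, f y ∂m.bind κ = ∫ a, ∫ y, f y ∂κ a ∂m := by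
  let η : ProbabilityTheory.Kernel α β := ⟨κ, hκ⟩
  have : ProbabilityTheory.IsMarkovKernel η := ⟨fun a => inferInstanceAs (IsProbabilityMeasure (κ a))⟩
  have h1 : m.bind κ = (m.compProd η).map Prod.snd := by
    rw [← Measure.snd, Measure.snd_compProd]
    rfl
  rw [h1] at hf ⊢
  rw [integral_map measurable_snd.aemeasurable hf.aestronglyMeasurable,
    Measure.integral_compProd (f := fun p => f p.2)
      ((integrable_map_measure hf.aestronglyMeasurable measurable_snd.aemeasurable).1 hf)]
  rfl

/-- Fubini and the product formula for two unit masses. -/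
lemma radCharFun_kingmanConv (hs : -(1 / 2) ≤ s) (G₁ G₂ : Measure (Fin k → ℝ≥0))
    [IsFiniteMeasure G₁] [IsFiniteMeasure G₂] (t : Fin k → ℝ≥0) :
    radCharFun s (kingmanConv s G₁ G₂) t = radCharFun s G₁ t * radCharFun s G₂ t := by
  have := isFiniteMeasure_kingmanConv hs G₁ G₂
  have h1 := integrable_kingmanKernelPi hs (kingmanConv s G₁ G₂) t
  have := fun p : (Fin k → ℝ≥0) × (Fin k → ℝ≥0) =>
    isProbabilityMeasure_kingmanDiracPi hs p.1 p.2
  unfold radCharFun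
  unfold kingmanConv at h1 ⊢
  rw [integral_bind_of_integrable (measurable_kingmanDiracPi hs) h1]
  have h2 : ∀ p : (Fin k → ℝ≥0) × (Fin k → ℝ≥0),
      ∫ y, kingmanKernelPi s t y ∂kingmanDiracPi s p.1 p.2 =
        kingmanKernelPi s t p.1 * kingmanKernelPi s t p.2 := fun p =>
    radCharFun_kingmanDiracPi hs t p.1 p.2
  simp only [h2]
  exact integral_prod_mul _ _

lemma isFiniteMeasure_kingmanPow (hs : -(1 / 2) ≤ s) (G : Measure (Fin k → ℝ≥0))
    [IsFiniteMeasure G] (n : ℕ) : IsFiniteMeasure (kingmanPow s G n) := by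
  induction n with
  | zero => exact inferInstanceAs (IsFiniteMeasure (Measure.dirac 0))
  | succ n ih => exact isFiniteMeasure_kingmanConv hs _ _

lemma kingmanPow_univ (hs : -(1 / 2) ≤ s) (G : Measure (Fin k → ℝ≥0))
    [IsFiniteMeasure G] (n : ℕ) : kingmanPow s G n univ = G univ ^ n := by
  induction n with
  | zero => simp [kingmanPow]
  | succ n ih =>
    have := isFiniteMeasure_kingmanPow hs G n
    rw [kingmanPow, kingmanConv_univ hs, ih, pow_succ]

lemma isProbabilityMeasure_kingmanPow (hs : -(1 / 2) ≤ s) (G : Measure (Fin k → ℝ≥0))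
    [IsProbabilityMeasure G] (n : ℕ) : IsProbabilityMeasure (kingmanPow s G n) :=
  ⟨by simp [kingmanPow_univ hs]⟩

lemma radCharFun_kingmanPow (hs : -(1 / 2) ≤ s) (G : Measure (Fin k → ℝ≥0))
    [IsFiniteMeasure G] (n : ℕ) (t : Fin k → ℝ≥0) :
    radCharFun s (kingmanPow s G n) t = radCharFun s G t ^ n := by
  induction n with
  | zero =>
    simp only [kingmanPow, radCharFun, pow_zero]
    rw [integral_dirac, kingmanKernelPi_zero_right hs]
  | succ n ih =>
    have := isFiniteMeasure_kingmanPow hs G n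
    rw [kingmanPow, radCharFun_kingmanConv hs, ih, pow_succ]

/-! ### Rayleigh products and Gaussian averages -/

/-- The law `T_{l_1} σ_s × ⋯ × T_{l_k} σ_s`. -/
noncomputable def rayleighPi (s : ℝ) (l : Fin k → ℝ≥0) : Measure (Fin k → ℝ≥0) :=
  Measure.pi fun j => (rayleighLaw s).map fun x => l j * x

lemma isProbabilityMeasure_map_rayleighLaw (hs : -(1 / 2) ≤ s) (c : ℝ≥0) :
    IsProbabilityMeasure ((rayleighLaw s).map fun x => c * x) :=
  have := isProbabilityMeasure_rayleighLaw hs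
  Measure.isProbabilityMeasure_map (by fun_prop)

lemma isProbabilityMeasure_rayleighPi (hs : -(1 / 2) ≤ s) (l : Fin k → ℝ≥0) :
    IsProbabilityMeasure (rayleighPi s l) :=
  have := fun j => isProbabilityMeasure_map_rayleighLaw hs (l j)
  inferInstanceAs (IsProbabilityMeasure (Measure.pi _))

lemma radCharFun_rayleighPi (hs : -(1 / 2) ≤ s) (l t : Fin k → ℝ≥0) :
    radCharFun s (rayleighPi s l) t =
      Real.exp (-∑ j, (l j : ℝ) ^ 2 * (t j : ℝ) ^ 2 / (4 * (s + 1))) := by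
  have := fun j => isProbabilityMeasure_map_rayleighLaw hs (l j)
  unfold radCharFun rayleighPi kingmanKernelPi
  rw [integral_fintype_prod_eq_prod (fun j (z : ℝ≥0) => kingmanKernel s (t j * z)),
    ← Finset.sum_neg_distrib, Real.exp_sum]
  refine Finset.prod_congr rfl fun j _ => ?_
  rw [integral_map (by fun_prop) (Continuous.aestronglyMeasurable
    (f := fun z : ℝ≥0 => kingmanKernel s (t j * z))
      ((continuous_kingmanKernel hs).comp (by fun_prop)))]
  simp only [NNReal.coe_mul, ← mul_assoc]
  have h := integral_kingmanKernel_rayleighLaw hs (t j * l j)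
  rw [h]
  congr 1
  ring

/-- The function `x ↦ exp (-∑ a_j x_j²)`. -/
noncomputable def gaussFun (a x : Fin k → ℝ≥0) : ℝ := Real.exp (-∑ j, (a j : ℝ) * (x j : ℝ) ^ 2)

lemma continuous_gaussFun (a : Fin k → ℝ≥0) : Continuous (gaussFun a) := by
  unfold gaussFun
  fun_prop

lemma gaussFun_pos (a x : Fin k → ℝ≥0) : 0 < gaussFun a x := Real.exp_pos _

lemma gaussFun_le_one (a x : Fin k → ℝ≥0) : gaussFun a x ≤ 1 := by
  unfold gaussFun
  rw [Real.exp_le_one_iff, neg_nonpos]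
  positivity

lemma gaussFun_add (a b x : Fin k → ℝ≥0) :
    gaussFun (a + b) x = gaussFun a x * gaussFun b x := by
  unfold gaussFun
  rw [← Real.exp_add]
  congr 1
  simp only [Pi.add_apply, NNReal.coe_add, add_mul, Finset.sum_add_distrib]
  ring

lemma gaussFun_zero (x : Fin k → ℝ≥0) : gaussFun 0 x = 1 := by
  simp [gaussFun]

lemma integrable_gaussFun (N : Measure (Fin k → ℝ≥0)) [IsFiniteMeasure N] (a : Fin k → ℝ≥0) :
    Integrable (gaussFun a) N :=
  Integrable.of_bound (continuous_gaussFun a).aestronglyMeasurable 1 (.of_forall fun x => by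
    rw [Real.norm_of_nonneg (gaussFun_pos a x).le]
    exact gaussFun_le_one a x)

/-- The law whose radial characteristic function is `gaussFun a`. -/
noncomputable def gaussMixing (s : ℝ) (a : Fin k → ℝ≥0) : Measure (Fin k → ℝ≥0) :=
  rayleighPi s fun j => NNReal.sqrt (a j * (4 * (s + 1)).toNNReal)

lemma isProbabilityMeasure_gaussMixing (hs : -(1 / 2) ≤ s) (a : Fin k → ℝ≥0) :
    IsProbabilityMeasure (gaussMixing s a) :=
  isProbabilityMeasure_rayleighPi hs _

/-- By symmetry the left side is the transform of a Rayleigh product at `x`; the scales `√(4 (s + 1)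
a_j)` absorb the factor `1 / (4 (s + 1))` in its exponent. -/
lemma integral_kingmanKernelPi_gaussMixing (hs : -(1 / 2) ≤ s) (a x : Fin k → ℝ≥0) :
    ∫ t, kingmanKernelPi s t x ∂gaussMixing s a = gaussFun a x := by
  have ha : 0 < s + 1 := by linarith
  have h := radCharFun_rayleighPi hs
    (fun j => NNReal.sqrt (a j * (4 * (s + 1)).toNNReal)) x
  unfold radCharFun at h
  simp only [kingmanKernelPi_comm s x] at h
  unfold gaussMixing
  rw [h]
  unfold gaussFun
  congr 2
  refine Finset.sum_congr rfl fun j _ => ?_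
  rw [Real.coe_sqrt, Real.sq_sqrt (NNReal.coe_nonneg _), NNReal.coe_mul,
    Real.coe_toNNReal _ (by positivity)]
  field_simp

lemma integral_radCharFun_gaussMixing (hs : -(1 / 2) ≤ s) (N : Measure (Fin k → ℝ≥0))
    [IsFiniteMeasure N] (a : Fin k → ℝ≥0) :
    ∫ t, radCharFun s N t ∂gaussMixing s a = ∫ x, gaussFun a x ∂N := by
  have := isProbabilityMeasure_gaussMixing hs a
  unfold radCharFun
  rw [integral_integral_swap]
  · simp only [integral_kingmanKernelPi_gaussMixing hs]
  · exact Integrable.of_bound (continuous_kingmanKernelPi₂ hs).aestronglyMeasurable 1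
      (.of_forall fun p => abs_kingmanKernelPi_le_one hs p.1 p.2)

/-- `gaussFun` as a bounded continuous function. -/
noncomputable def gaussBCF (a : Fin k → ℝ≥0) : BoundedContinuousFunction (Fin k → ℝ≥0) ℝ :=
  BoundedContinuousFunction.ofNormedAddCommGroup (gaussFun a) (continuous_gaussFun a) 1 fun x => by
    rw [Real.norm_of_nonneg (gaussFun_pos a x).le]
    exact gaussFun_le_one a x

/-- Finite measures on the cone are determined by their integrals of `gaussFun a`. -/
theorem ext_of_integral_gaussFun {N N' : Measure (Fin k → ℝ≥0)} [IsFiniteMeasure N]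
    [IsFiniteMeasure N'] (h : ∀ a, ∫ x, gaussFun a x ∂N = ∫ x, gaussFun a x ∂N') : N = N' := by
  -- The Gaussian functions contain `1` and are closed under products, so the algebra they generate
  -- is merely their linear span, and equality of integrals passes to it by linearity.
  let S : Submonoid (BoundedContinuousFunction (Fin k → ℝ≥0) ℝ) :=
    { carrier := range gaussBCF
      one_mem' := ⟨0, by
        ext x
        exact gaussFun_zero x⟩
      mul_mem' := by
        rintro _ _ ⟨a, rfl⟩ ⟨b, rfl⟩
        exact ⟨a + b, by
          ext x
          exact gaussFun_add a b x⟩ }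
  let A : StarSubalgebra ℝ (BoundedContinuousFunction (Fin k → ℝ≥0) ℝ) :=
    { Algebra.adjoin ℝ (S : Set (BoundedContinuousFunction (Fin k → ℝ≥0) ℝ)) with
      star_mem' := fun {f} hf => by
        have : star f = f := by
          ext x
          simp
        rwa [this] }
  have hA : ∀ g ∈ A, g ∈ Submodule.span ℝ (range (gaussBCF (k := k))) := by
    intro g hg
    have hg : g ∈ Subalgebra.toSubmodule
      (Algebra.adjoin ℝ (S : Set (BoundedContinuousFunction (Fin k → ℝ≥0) ℝ))) := hg
    rw [Algebra.adjoin_eq_span, Submonoid.closure_eq] at hg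
    exact hg
  refine ext_of_forall_mem_subalgebra_integral_eq_of_polish (A := A) ?_ ?_
  · intro x y hxy
    obtain ⟨j, hj⟩ := Function.ne_iff.1 hxy
    -- One coordinate separates: squaring is injective on nonnegative coordinates.
    refine ⟨gaussFun (Pi.single j 1), ⟨gaussBCF (Pi.single j 1), ?_, rfl⟩, ?_⟩
    · exact ⟨gaussBCF (Pi.single j 1), Algebra.subset_adjoin ⟨_, rfl⟩, rfl⟩
    · have e : ∀ z : Fin k → ℝ≥0, gaussFun (Pi.single j 1) z = Real.exp (-(z j : ℝ) ^ 2) := by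
        intro z
        unfold gaussFun
        rw [Finset.sum_eq_single j]
        · simp
        · intro i _ hi
          simp [hi]
        · simp
      rw [e, e]
      intro h
      have h1 := neg_injective (Real.exp_injective h)
      rw [sq_eq_sq₀ (NNReal.coe_nonneg _) (NNReal.coe_nonneg _), NNReal.coe_inj] at h1
      exact hj h1
  · intro g hg
    replace hg := hA g hg
    induction hg using Submodule.span_induction with
    | mem f hf =>
      obtain ⟨a, rfl⟩ := hf
      exact h a
    | zero => simp
    | add f g _ _ hf hg =>
      simp only [BoundedContinuousFunction.coe_add, Pi.add_apply]
      rw [integral_add (f.integrable _) (g.integrable _),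
        integral_add (f.integrable _) (g.integrable _), hf, hg]
    | smul c f _ hf =>
      simp only [BoundedContinuousFunction.coe_smul]
      rw [integral_smul, integral_smul, hf]

/-- Finite measures on the cone are determined by their radial characteristic functions. -/
theorem ext_of_radCharFun (hs : -(1 / 2) ≤ s) {N N' : Measure (Fin k → ℝ≥0)} [IsFiniteMeasure N]
    [IsFiniteMeasure N'] (h : ∀ t, radCharFun s N t = radCharFun s N' t) : N = N' := by
  refine ext_of_integral_gaussFun fun a => ?_
  rw [← integral_radCharFun_gaussMixing hs, ← integral_radCharFun_gaussMixing hs, funext h]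

end Cone

/-! ### The Lévy integrand: bounds and behaviour at the origin. -/

section LevyIntegrand

variable {k : ℕ} {s : ℝ}

lemma coneNormSq_nonneg (x : Fin k → ℝ≥0) : 0 ≤ coneNormSq x := by
  unfold coneNormSq
  positivity

lemma continuous_coneNormSq : Continuous (coneNormSq (k := k)) := by
  unfold coneNormSq
  fun_prop

lemma coneNormSq_zero : coneNormSq (0 : Fin k → ℝ≥0) = 0 := by
  simp [coneNormSq]

lemma sq_le_coneNormSq (x : Fin k → ℝ≥0) (j : Fin k) : (x j : ℝ) ^ 2 ≤ coneNormSq x := by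
  unfold coneNormSq
  exact Finset.single_le_sum (f := fun j => (x j : ℝ) ^ 2) (fun _ _ => sq_nonneg _)
    (Finset.mem_univ j)

lemma coneNormSq_pos {x : Fin k → ℝ≥0} (hx : x ≠ 0) : 0 < coneNormSq x := by
  obtain ⟨j, hj⟩ := Function.ne_iff.1 hx
  have : 0 < x j := pos_iff_ne_zero.2 hj
  exact lt_of_lt_of_le (by positivity) (sq_le_coneNormSq x j)

lemma gaussFun_one (x : Fin k → ℝ≥0) : gaussFun 1 x = Real.exp (-coneNormSq x) := by
  simp [gaussFun, coneNormSq]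

lemma tendsto_coneNormSq : Tendsto (coneNormSq (k := k)) (𝓝 0) (𝓝 0) := by
  have := (continuous_coneNormSq (k := k)).tendsto 0
  rwa [coneNormSq_zero] at this

lemma one_sub_kingmanKernelPi_le (hs : -(1 / 2) ≤ s) (t x : Fin k → ℝ≥0) :
    1 - kingmanKernelPi s t x ≤ coneNormSq t * coneNormSq x := by
  have ha : 0 < s + 1 := by linarith
  refine (one_sub_kingmanKernelPi_le_sum hs t x).trans ?_
  unfold coneNormSq
  rw [Finset.sum_mul]
  refine Finset.sum_le_sum fun j _ => ?_
  calc 1 - kingmanKernel s (t j * x j) ≤ ((t j : ℝ) * x j) ^ 2 / (4 * (s + 1)) :=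
        one_sub_kingmanKernel_le hs _
    _ ≤ ((t j : ℝ) * x j) ^ 2 := div_le_self (sq_nonneg _) (by linarith)
    _ = (t j : ℝ) ^ 2 * (x j : ℝ) ^ 2 := by ring
    _ ≤ _ := by
        gcongr
        exact sq_le_coneNormSq x j

lemma levyIntegrand_nonneg (hs : -(1 / 2) ≤ s) (t x : Fin k → ℝ≥0) : 0 ≤ levyIntegrand s t x :=
  mul_nonneg (one_sub_kingmanKernelPi_nonneg hs t x)
    (div_nonneg (by linarith [coneNormSq_nonneg x]) (coneNormSq_nonneg x))

/-- Split `(1 + n) / n = 1 + 1 / n`: the bound `2` serves the first part and `A * n` the second. For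
`n = 0` the quotient is `0` by convention. -/
lemma mul_one_add_div_le {b A n : ℝ} (hn : 0 ≤ n) (hA : 0 ≤ A) (h2 : b ≤ 2) (h1 : b ≤ A * n) :
    b * ((1 + n) / n) ≤ 2 + A := by
  rcases hn.eq_or_lt with rfl | hn
  · simp
    linarith
  · rw [mul_div_assoc', div_le_iff₀ hn]
    nlinarith

lemma levyIntegrand_le (hs : -(1 / 2) ≤ s) (t x : Fin k → ℝ≥0) :
    levyIntegrand s t x ≤ 2 + coneNormSq t :=
  mul_one_add_div_le (coneNormSq_nonneg x) (coneNormSq_nonneg t)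
    (by linarith [(abs_le.1 (abs_kingmanKernelPi_le_one hs t x)).1])
    (one_sub_kingmanKernelPi_le hs t x)

lemma measurable_levyIntegrand₂ (hs : -(1 / 2) ≤ s) :
    Measurable fun p : (Fin k → ℝ≥0) × (Fin k → ℝ≥0) => levyIntegrand s p.1 p.2 := by
  have h1 := (continuous_kingmanKernelPi₂ (k := k) hs).measurable
  have h2 := (continuous_coneNormSq (k := k)).measurable
  unfold levyIntegrand
  fun_prop

lemma measurable_levyIntegrand (hs : -(1 / 2) ≤ s) (t : Fin k → ℝ≥0) :
    Measurable (levyIntegrand s t) := by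
  have h1 := (continuous_kingmanKernelPi (k := k) hs t).measurable
  have h2 := (continuous_coneNormSq (k := k)).measurable
  unfold levyIntegrand
  fun_prop

lemma integrable_levyIntegrand (hs : -(1 / 2) ≤ s) (M : Measure (Fin k → ℝ≥0)) [IsFiniteMeasure M]
    (t : Fin k → ℝ≥0) : Integrable (levyIntegrand s t) M :=
  Integrable.of_bound (measurable_levyIntegrand hs t).aestronglyMeasurable (2 + coneNormSq t)
    (.of_forall fun x => by
      rw [Real.norm_of_nonneg (levyIntegrand_nonneg hs t x)]
      exact levyIntegrand_le hs t x)

/-- The second-order expansion of the product kernel at the origin. -/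
lemma kingmanKernelPi_sub_isLittleO (hs : -(1 / 2) ≤ s) (t : Fin k → ℝ≥0) :
    (fun x : Fin k → ℝ≥0 => kingmanKernelPi s t x -
      (1 - ∑ j, (t j : ℝ) ^ 2 * (x j : ℝ) ^ 2 / (4 * (s + 1)))) =o[𝓝 0] coneNormSq := by
  have ha : 0 < s + 1 := by linarith
  set q : Fin k → (Fin k → ℝ≥0) → ℝ := fun j x =>
    (t j : ℝ) ^ 2 * (x j : ℝ) ^ 2 / (4 * (s + 1)) with hq
  have hqO : ∀ j, q j =O[𝓝 0] coneNormSq := by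
    intro j
    refine Asymptotics.IsBigO.of_bound ((t j : ℝ) ^ 2 / (4 * (s + 1))) (.of_forall fun x => ?_)
    rw [Real.norm_of_nonneg (by positivity), Real.norm_of_nonneg (coneNormSq_nonneg x)]
    calc q j x = (t j : ℝ) ^ 2 / (4 * (s + 1)) * (x j : ℝ) ^ 2 := by simp only [hq]; ring
      _ ≤ _ := by
        gcongr
        exact sq_le_coneNormSq x j
  have hq0 : ∀ j, Tendsto (q j) (𝓝 0) (𝓝 0) := fun j => (hqO j).trans_tendsto tendsto_coneNormSq
  have hone : ∀ j, (fun x : Fin k → ℝ≥0 => kingmanKernel s (t j * x j) - (1 - q j x)) =o[𝓝 0]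
      coneNormSq := by
    intro j
    have h1 : (fun x : Fin k → ℝ≥0 => kingmanKernel s (t j * x j) - (1 - q j x)) =O[𝓝 0]
        fun x => coneNormSq x ^ 2 := by
      refine Asymptotics.IsBigO.of_bound ((t j : ℝ) ^ 4) ?_
      have h2 : Tendsto (fun x : Fin k → ℝ≥0 => |(t j : ℝ) * x j|) (𝓝 0) (𝓝 0) := by
        have : Continuous fun x : Fin k → ℝ≥0 => |(t j : ℝ) * x j| := by fun_prop
        simpa using this.tendsto 0
      filter_upwards [h2.eventually_lt_const one_pos] with x hx
      rw [Real.norm_of_nonneg (sq_nonneg _), Real.norm_eq_abs]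
      have h3 := abs_kingmanKernel_sub_le hs hx.le
      have h4 : q j x = ((t j : ℝ) * x j) ^ 2 / (4 * (s + 1)) := by simp only [hq, mul_pow]
      rw [h4]
      refine h3.trans ?_
      have h5 := sq_le_coneNormSq x j
      calc ((t j : ℝ) * x j) ^ 4 = (t j : ℝ) ^ 4 * ((x j : ℝ) ^ 2) ^ 2 := by ring
        _ ≤ _ := by gcongr
    refine h1.trans_isLittleO ?_
    have h6 : (fun x : Fin k → ℝ≥0 => coneNormSq x * coneNormSq x) =o[𝓝 0]
        fun x => coneNormSq x * 1 :=
      (Asymptotics.isBigO_refl _ _).mul_isLittleO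
        ((Asymptotics.isLittleO_one_iff ℝ).2 tendsto_coneNormSq)
    simpa [sq] using h6
  have key : ∀ S : Finset (Fin k), (fun x : Fin k → ℝ≥0 =>
      ∏ j ∈ S, kingmanKernel s (t j * x j) - (1 - ∑ j ∈ S, q j x)) =o[𝓝 0] coneNormSq := by
    intro S
    induction S using Finset.induction_on with
    | empty => simp
    | insert a S haS ih =>
      -- Besides the two remainders, multiplying `1 - q a` by `1 - ∑ q j` leaves only the cross term
      -- `q a * ∑ q j`, which is a quadratic times something tending to `0`.
      have e : (fun x : Fin k → ℝ≥0 => ∏ j ∈ insert a S, kingmanKernel s (t j * x j)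
          - (1 - ∑ j ∈ insert a S, q j x)) = fun x =>
          (kingmanKernel s (t a * x a) - (1 - q a x)) * ∏ j ∈ S, kingmanKernel s (t j * x j) +
          (1 - q a x) * (∏ j ∈ S, kingmanKernel s (t j * x j) - (1 - ∑ j ∈ S, q j x)) +
          q a x * ∑ j ∈ S, q j x := by
        funext x
        rw [Finset.prod_insert haS, Finset.sum_insert haS]
        ring
      rw [e]
      refine Asymptotics.IsLittleO.add (Asymptotics.IsLittleO.add ?_ ?_) ?_
      · have hb : (fun x : Fin k → ℝ≥0 => ∏ j ∈ S, kingmanKernel s (t j * x j)) =O[𝓝 0]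
            fun _ => (1 : ℝ) := by
          refine Asymptotics.IsBigO.of_bound 1 (.of_forall fun x => ?_)
          rw [Real.norm_eq_abs, Finset.abs_prod, norm_one, mul_one]
          exact Finset.prod_le_one (fun _ _ => abs_nonneg _)
            fun _ _ => abs_kingmanKernel_le_one hs _
        simpa using (hone a).mul_isBigO hb
      · have hb : (fun x => 1 - q a x) =O[𝓝 0] fun _ => (1 : ℝ) :=
          (tendsto_const_nhds.sub (hq0 a)).isBigO_one ℝ
        simpa using hb.mul_isLittleO ih
      · have hb : (fun x => ∑ j ∈ S, q j x) =o[𝓝 0] fun _ => (1 : ℝ) := by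
          rw [Asymptotics.isLittleO_one_iff]
          simpa using tendsto_finsetSum S fun j _ => hq0 j
        simpa using (hqO a).mul_isLittleO hb
  exact key Finset.univ

/-- A measure integrating `levyIntegrand s 1` which is finite off the origin is finite. -/
lemma IsLevyMeasure.isFiniteMeasure (hs : -(1 / 2) ≤ s) {M : Measure (Fin k → ℝ≥0)}
    (hM : IsLevyMeasure M) (hint : Integrable (levyIntegrand s 1) M) : IsFiniteMeasure M := by
  have ha : 0 < s + 1 := by linarith
  set c : ℝ := 1 / (4 * (s + 1)) with hc
  have hc0 : 0 < c := by positivity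
  have h1 := (kingmanKernelPi_sub_isLittleO (k := k) hs 1).def (half_pos hc0)
  set U : Set (Fin k → ℝ≥0) := {x | ‖kingmanKernelPi s 1 x -
      (1 - ∑ j, ((1 : Fin k → ℝ≥0) j : ℝ) ^ 2 * (x j : ℝ) ^ 2 / (4 * (s + 1)))‖ ≤
        c / 2 * ‖coneNormSq x‖} with hU
  have hU0 : U ∈ 𝓝 (0 : Fin k → ℝ≥0) := h1
  -- The origin is null and `Uᶜ` has finite mass. On `U` without the origin the expansion gives `1 -
  -- K ≥ (c / 2) ‖x‖²`, so the integrand is at least `c / 2` and Markov's inequality applies.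
  have hsub : univ ⊆ {0} ∪ {x | ENNReal.ofReal (c / 2) ≤ ENNReal.ofReal (levyIntegrand s 1 x)}
      ∪ Uᶜ := by
    intro x _
    by_cases hx0 : x = 0
    · simp [hx0]
    by_cases hxU : x ∈ U
    · left; right
      have hn := coneNormSq_pos hx0
      have h2 : ‖kingmanKernelPi s 1 x -
        (1 - ∑ j, ((1 : Fin k → ℝ≥0) j : ℝ) ^ 2 * (x j : ℝ) ^ 2 / (4 * (s + 1)))‖ ≤
        c / 2 * ‖coneNormSq x‖ := hxU
      have h3 : ∑ j, ((1 : Fin k → ℝ≥0) j : ℝ) ^ 2 * (x j : ℝ) ^ 2 / (4 * (s + 1)) =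
          c * coneNormSq x := by
        unfold coneNormSq
        rw [Finset.mul_sum]
        refine Finset.sum_congr rfl fun j _ => ?_
        rw [hc, Pi.one_apply]
        push_cast
        field_simp
      rw [h3, Real.norm_of_nonneg hn.le, Real.norm_eq_abs] at h2
      have h4 := (abs_le.1 h2).2
      refine ENNReal.ofReal_le_ofReal ?_
      unfold levyIntegrand
      rw [mul_div_assoc', le_div_iff₀ hn]
      have h5 : c / 2 * coneNormSq x ≤ 1 - kingmanKernelPi s 1 x := by linarith
      have h6 : 0 ≤ 1 - kingmanKernelPi s 1 x := one_sub_kingmanKernelPi_nonneg hs 1 x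
      nlinarith
    · right; exact hxU
  constructor
  refine (measure_mono hsub).trans_lt ((measure_union_le _ _).trans_lt (ENNReal.add_lt_top.2
    ⟨(measure_union_le _ _).trans_lt (ENNReal.add_lt_top.2 ⟨?_, ?_⟩), hM.finite_compl U hU0⟩))
  · rw [hM.zero]
    simp
  · refine (meas_ge_le_lintegral_div ?_ ?_ ENNReal.ofReal_ne_top).trans_lt
      (ENNReal.div_lt_top ?_ ?_)
    · exact (measurable_levyIntegrand hs 1).ennreal_ofReal.aemeasurable
    · simpa using hc0
    · exact hint.lintegral_lt_top.ne
    · simpa using hc0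

/-! ### Gaussian averages of the exponent and uniqueness. -/

/-- The point is that the mean is linear in `a`: second differences in `a` then annihilate the
averaged Rayleigh part. -/
lemma integral_sq_gaussMixing (hs : -(1 / 2) ≤ s) (a : Fin k → ℝ≥0) (j : Fin k) :
    Integrable (fun t : Fin k → ℝ≥0 => (t j : ℝ) ^ 2) (gaussMixing s a) ∧
      ∫ t, (t j : ℝ) ^ 2 ∂gaussMixing s a = 4 * (s + 1) * a j := by
  have ha : 0 < s + 1 := by linarith
  set l : Fin k → ℝ≥0 := fun j => NNReal.sqrt (a j * (4 * (s + 1)).toNNReal)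
  have := fun j => isProbabilityMeasure_map_rayleighLaw hs (l j)
  have hmp := measurePreserving_eval (fun j => (rayleighLaw s).map fun x => l j * x) j
  have hm : AEStronglyMeasurable (fun z : ℝ≥0 => (z : ℝ) ^ 2)
      ((rayleighLaw s).map fun x => l j * x) := by fun_prop
  have h1 := integrable_pow_rayleighLaw hs 1
  have h2 := integral_pow_rayleighLaw hs 1
  simp only [mul_one, pow_one] at h1 h2
  constructor
  · refine (hmp.integrable_comp hm).2 ?_
    rw [integrable_map_measure hm (by fun_prop)]
    refine (h1.const_mul ((l j : ℝ) ^ 2)).congr (.of_forall fun z => ?_)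
    simp [mul_pow]
  · have h3 : ∫ t : Fin k → ℝ≥0, (t j : ℝ) ^ 2 ∂gaussMixing s a =
        ∫ z, (z : ℝ) ^ 2 ∂((rayleighLaw s).map fun x => l j * x) := by
      rw [← hmp.map_eq] at hm ⊢
      rw [integral_map (measurable_pi_apply j).aemeasurable hm]
      rfl
    rw [h3, integral_map (by fun_prop) hm]
    simp only [NNReal.coe_mul, mul_pow]
    rw [integral_const_mul, h2]
    simp only [l]
    rw [Real.coe_sqrt, Real.sq_sqrt (NNReal.coe_nonneg _), NNReal.coe_mul,
      Real.coe_toNNReal _ (by positivity)]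
    simp [risingFactorial]
    field_simp

lemma integrable_coneNormSq_gaussMixing (hs : -(1 / 2) ≤ s) (a : Fin k → ℝ≥0) :
    Integrable coneNormSq (gaussMixing s a) := by
  unfold coneNormSq
  exact integrable_finsetSum _ fun j _ => (integral_sq_gaussMixing hs a j).1

lemma integral_levyIntegrand_gaussMixing (hs : -(1 / 2) ≤ s) (a x : Fin k → ℝ≥0) :
    ∫ t, levyIntegrand s t x ∂gaussMixing s a =
      (1 - gaussFun a x) * ((1 + coneNormSq x) / coneNormSq x) := by
  have := isProbabilityMeasure_gaussMixing hs a
  unfold levyIntegrand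
  have hint : Integrable (fun t => kingmanKernelPi s t x) (gaussMixing s a) := by
    simp only [kingmanKernelPi_comm s _ x]
    exact integrable_kingmanKernelPi hs _ x
  rw [integral_mul_const, integral_sub (integrable_const _) hint,
    integral_kingmanKernelPi_gaussMixing hs]
  simp

/-- The Gaussian average of the Lévy-Khinchine exponent. -/
lemma HasLevyRep.integral_neg_log (hs : -(1 / 2) ≤ s) {μ M : Measure (Fin k → ℝ≥0)}
    {l : Fin k → ℝ≥0} (h : HasLevyRep s μ M l) (a : Fin k → ℝ≥0) :
    ∫ t, -Real.log (radCharFun s μ t) ∂gaussMixing s a =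
      ∑ j, (l j : ℝ) ^ 2 * (4 * (s + 1) * a j) +
        ∫ x, (1 - gaussFun a x) * ((1 + coneNormSq x) / coneNormSq x) ∂M := by
  have := h.levy.isFiniteMeasure hs (h.integrable 1)
  have := isProbabilityMeasure_gaussMixing hs a
  have hprod : Integrable (fun p : (Fin k → ℝ≥0) × (Fin k → ℝ≥0) => levyIntegrand s p.1 p.2)
      ((gaussMixing s a).prod M) := by
    have hb : Integrable (fun p : (Fin k → ℝ≥0) × (Fin k → ℝ≥0) => 2 + coneNormSq p.1)
        ((gaussMixing s a).prod M) :=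
      (integrable_const _).add ((integrable_coneNormSq_gaussMixing hs a).comp_fst M)
    refine hb.mono' (measurable_levyIntegrand₂ hs).aestronglyMeasurable (.of_forall fun p => ?_)
    rw [Real.norm_of_nonneg (levyIntegrand_nonneg hs _ _)]
    exact levyIntegrand_le hs _ _
  simp only [h.eq]
  have hi : ∀ j ∈ Finset.univ, Integrable (fun t : Fin k → ℝ≥0 => (l j : ℝ) ^ 2 * (t j : ℝ) ^ 2)
      (gaussMixing s a) := fun j _ => (integral_sq_gaussMixing hs a j).1.const_mul _
  rw [integral_add (integrable_finsetSum _ hi) hprod.integral_prod_left,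
    integral_finsetSum _ hi, integral_integral_swap hprod]
  congr 1
  · refine Finset.sum_congr rfl fun j _ => ?_
    rw [integral_const_mul, (integral_sq_gaussMixing hs a j).2]
  · simp only [integral_levyIntegrand_gaussMixing hs]

/-- The weight produced by second differences of Gaussian averages. -/
noncomputable def gaussWeight (x : Fin k → ℝ≥0) : ℝ :=
  (1 - gaussFun 1 x) ^ 2 * ((1 + coneNormSq x) / coneNormSq x)

lemma one_sub_gaussFun_mul_le (a x : Fin k → ℝ≥0) :
    (1 - gaussFun a x) * ((1 + coneNormSq x) / coneNormSq x) ≤ 2 + ∑ j, (a j : ℝ) := by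
  refine mul_one_add_div_le (coneNormSq_nonneg x) (by positivity)
    (by linarith [gaussFun_pos a x]) ?_
  unfold gaussFun
  have h1 := Real.add_one_le_exp (-∑ j, (a j : ℝ) * (x j : ℝ) ^ 2)
  have h2 : ∑ j, (a j : ℝ) * (x j : ℝ) ^ 2 ≤ (∑ j, (a j : ℝ)) * coneNormSq x := by
    rw [Finset.sum_mul]
    exact Finset.sum_le_sum fun j _ => by
      gcongr
      exact sq_le_coneNormSq x j
  linarith

lemma gaussWeight_nonneg (x : Fin k → ℝ≥0) : 0 ≤ gaussWeight x :=
  mul_nonneg (sq_nonneg _)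
    (div_nonneg (by linarith [coneNormSq_nonneg x]) (coneNormSq_nonneg x))

lemma gaussWeight_pos {x : Fin k → ℝ≥0} (hx : x ≠ 0) : 0 < gaussWeight x := by
  have hn := coneNormSq_pos hx
  have h1 : gaussFun 1 x < 1 := by
    rw [gaussFun_one, Real.exp_lt_one_iff]
    linarith
  have h2 : 0 < 1 - gaussFun 1 x := by linarith
  unfold gaussWeight
  positivity

lemma measurable_gaussWeight : Measurable (gaussWeight (k := k)) := by
  have h1 := (continuous_gaussFun (1 : Fin k → ℝ≥0)).measurable
  have h2 := (continuous_coneNormSq (k := k)).measurable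
  unfold gaussWeight
  fun_prop

lemma integrable_one_sub_gaussFun_mul (M : Measure (Fin k → ℝ≥0)) [IsFiniteMeasure M]
    (a : Fin k → ℝ≥0) :
    Integrable (fun x => (1 - gaussFun a x) * ((1 + coneNormSq x) / coneNormSq x)) M := by
  have h1 := (continuous_gaussFun a).measurable
  have h2 := (continuous_coneNormSq (k := k)).measurable
  refine Integrable.of_bound (Measurable.aestronglyMeasurable (by fun_prop)) (2 + ∑ j, (a j : ℝ))
    (.of_forall fun x => ?_)
  rw [Real.norm_of_nonneg]
  · exact one_sub_gaussFun_mul_le a x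
  · exact mul_nonneg (by linarith [gaussFun_le_one a x])
      (div_nonneg (by linarith [coneNormSq_nonneg x]) (coneNormSq_nonneg x))

/-- With `g = gaussFun 1 x`, this integrates `gaussFun a x * (1 - g)² = gaussFun a x * (1 - 2 g +
g²)`, written through the functions `1 - gaussFun` because only these are integrable against the
singular factor with a uniform bound. -/
lemma integral_gaussFun_mul_gaussWeight (M : Measure (Fin k → ℝ≥0)) [IsFiniteMeasure M]
    (a : Fin k → ℝ≥0) : ∫ x, gaussWeight x * gaussFun a x ∂M =
      2 * ∫ x, (1 - gaussFun (a + 1) x) * ((1 + coneNormSq x) / coneNormSq x) ∂M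
        - ∫ x, (1 - gaussFun a x) * ((1 + coneNormSq x) / coneNormSq x) ∂M
        - ∫ x, (1 - gaussFun (a + 1 + 1) x) * ((1 + coneNormSq x) / coneNormSq x) ∂M := by
  have h1 := integrable_one_sub_gaussFun_mul M a
  have h2 := integrable_one_sub_gaussFun_mul M (a + 1)
  have h3 := integrable_one_sub_gaussFun_mul M (a + 1 + 1)
  have h4 : Integrable (fun x => 2 * ((1 - gaussFun (a + 1) x) *
      ((1 + coneNormSq x) / coneNormSq x)) -
        (1 - gaussFun a x) * ((1 + coneNormSq x) / coneNormSq x)) M := (h2.const_mul 2).sub h1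
  rw [← integral_const_mul, ← integral_sub (h2.const_mul 2) h1, ← integral_sub h4 h3]
  refine integral_congr_ae (.of_forall fun x => ?_)
  simp only [gaussWeight, gaussFun_add]
  ring

/-- Second differences of the averaged exponent determine all Gaussian integrals of the finite
measure with density `gaussWeight` against `M`. The weight is positive off the origin, where `M`
lives, so it can be divided out; then `t = e_j` isolates `l j`. -/
theorem HasLevyRep.unique (hs : -(1 / 2) ≤ s) {μ M M' : Measure (Fin k → ℝ≥0)}
    {l l' : Fin k → ℝ≥0} (h : HasLevyRep s μ M l) (h' : HasLevyRep s μ M' l') :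
    M = M' ∧ l = l' := by
  have := h.levy.isFiniteMeasure hs (h.integrable 1)
  have := h'.levy.isFiniteMeasure hs (h'.integrable 1)
  set w : (Fin k → ℝ≥0) → ℝ≥0∞ := fun x => ENNReal.ofReal (gaussWeight x)
  have hw : Measurable w := measurable_gaussWeight.ennreal_ofReal
  have hwint : ∀ N : Measure (Fin k → ℝ≥0), IsFiniteMeasure N → Integrable gaussWeight N := by
    intro N _
    have h0 := integrable_one_sub_gaussFun_mul N 1
    refine h0.mono' measurable_gaussWeight.aestronglyMeasurable (.of_forall fun x => ?_)
    rw [Real.norm_of_nonneg (gaussWeight_nonneg x)]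
    unfold gaussWeight
    have h1 := gaussFun_le_one 1 x
    have h2 := gaussFun_pos 1 x
    have h3 : 0 ≤ (1 + coneNormSq x) / coneNormSq x :=
      div_nonneg (by linarith [coneNormSq_nonneg x]) (coneNormSq_nonneg x)
    gcongr
    nlinarith
  have hfin : ∀ N : Measure (Fin k → ℝ≥0), IsFiniteMeasure N →
      IsFiniteMeasure (N.withDensity w) := fun N hN =>
    isFiniteMeasure_withDensity (hwint N hN).lintegral_lt_top.ne
  have := hfin M inferInstance
  have := hfin M' inferInstance
  have hden : ∀ (N : Measure (Fin k → ℝ≥0)) (a : Fin k → ℝ≥0),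
      ∫ x, gaussFun a x ∂N.withDensity w = ∫ x, gaussWeight x * gaussFun a x ∂N := by
    intro N a
    rw [integral_withDensity_eq_integral_toReal_smul hw (by simp [w])]
    simp only [w, ENNReal.toReal_ofReal (gaussWeight_nonneg _), smul_eq_mul]
  have hW : M.withDensity w = M'.withDensity w := by
    refine ext_of_integral_gaussFun fun a => ?_
    rw [hden, hden, integral_gaussFun_mul_gaussWeight, integral_gaussFun_mul_gaussWeight]
    have e := fun b => (h.integral_neg_log hs b).symm.trans (h'.integral_neg_log hs b)
    -- The Rayleigh part is linear along `a`, `a + 1`, `a + 1 + 1`.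
    have lin : ∀ m : Fin k → ℝ≥0, 2 * ∑ j, (m j : ℝ) ^ 2 * (4 * (s + 1) * (a + 1) j)
        - ∑ j, (m j : ℝ) ^ 2 * (4 * (s + 1) * a j)
        - ∑ j, (m j : ℝ) ^ 2 * (4 * (s + 1) * (a + 1 + 1) j) = 0 := by
      intro m
      rw [Finset.mul_sum, ← Finset.sum_sub_distrib, ← Finset.sum_sub_distrib]
      refine Finset.sum_eq_zero fun j _ => ?_
      simp only [Pi.add_apply, Pi.one_apply, NNReal.coe_add, NNReal.coe_one]
      ring
    have e0 := e a
    have e1 := e (a + 1)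
    have e2 := e (a + 1 + 1)
    have l1 := lin l
    have l2 := lin l'
    linarith
  have hback : ∀ N : Measure (Fin k → ℝ≥0), N {0} = 0 →
      (N.withDensity w).withDensity w⁻¹ = N := by
    intro N hN
    refine withDensity_inv_same hw ?_ (.of_forall fun x => ENNReal.ofReal_ne_top)
    have : ∀ᵐ x ∂N, x ≠ 0 := by
      rw [ae_iff]
      simpa using hN
    filter_upwards [this] with x hx
    simpa [w] using gaussWeight_pos hx
  have hMM : M = M' := by
    rw [← hback M h.levy.zero, ← hback M' h'.levy.zero, hW]
  refine ⟨hMM, ?_⟩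
  subst hMM
  funext j
  have h1 := h.eq (Pi.single j 1)
  rw [h'.eq] at h1
  have h2 : ∀ m : Fin k → ℝ≥0, ∑ i, (m i : ℝ) ^ 2 *
      ((Pi.single j 1 : Fin k → ℝ≥0) i : ℝ) ^ 2 = (m j : ℝ) ^ 2 := by
    intro m
    rw [Finset.sum_eq_single j]
    · simp
    · intro i _ hi
      simp [hi]
    · simp
  rw [h2, h2, add_left_inj, sq_eq_sq₀ (NNReal.coe_nonneg _) (NNReal.coe_nonneg _),
    NNReal.coe_inj] at h1
  exact h1.symm

/-! ### Rayleighian laws -/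

lemma pos_and_neg_log_eq_iff {y q : ℝ} : (0 < y ∧ -Real.log y = q) ↔ y = Real.exp (-q) := by
  constructor
  · rintro ⟨hy, rfl⟩
    rw [neg_neg, Real.exp_log hy]
  · rintro rfl
    exact ⟨Real.exp_pos _, by rw [Real.log_exp, neg_neg]⟩

/-- Any `c > 0` can be absorbed into `l` by rescaling with a square root, so the normalizations `c =
1` and `c = 1/2` describe the same class. The converse direction rests on injectivity of the
transform. -/
lemma isRayleighian_iff (hs : -(1 / 2) ≤ s) (μ : Measure (Fin k → ℝ≥0)) [IsProbabilityMeasure μ]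
    {c : ℝ} (hc : 0 < c) : IsRayleighian s μ ↔ ∃ l : Fin k → ℝ≥0, ∀ t,
      radCharFun s μ t = Real.exp (-(c * ∑ j, (l j : ℝ) ^ 2 * (t j : ℝ) ^ 2)) := by
  have ha : 0 < s + 1 := by linarith
  have h4 : 0 < 4 * (s + 1) := by positivity
  constructor
  · rintro ⟨l, hl⟩
    refine ⟨fun j => l j * NNReal.sqrt (1 / (c * (4 * (s + 1)))).toNNReal, fun t => ?_⟩
    have h := radCharFun_rayleighPi hs l t
    rw [rayleighPi, ← hl] at h
    rw [h, Finset.mul_sum]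
    congr 2
    refine Finset.sum_congr rfl fun j _ => ?_
    rw [NNReal.coe_mul, mul_pow, Real.coe_sqrt, Real.sq_sqrt (NNReal.coe_nonneg _),
      Real.coe_toNNReal _ (by positivity)]
    field_simp
  · rintro ⟨l, hl⟩
    refine ⟨fun j => l j * NNReal.sqrt (c * (4 * (s + 1))).toNNReal, ?_⟩
    have := isProbabilityMeasure_rayleighPi hs
      fun j => l j * NNReal.sqrt (c * (4 * (s + 1))).toNNReal
    refine ext_of_radCharFun hs (N' := rayleighPi s _) fun t => ?_
    rw [hl, radCharFun_rayleighPi hs, Finset.mul_sum]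
    congr 2
    refine Finset.sum_congr rfl fun j _ => ?_
    rw [NNReal.coe_mul, mul_pow, Real.coe_sqrt, Real.sq_sqrt (NNReal.coe_nonneg _),
      Real.coe_toNNReal _ (by positivity)]
    field_simp

lemma isLevyMeasure_zero : IsLevyMeasure (0 : Measure (Fin k → ℝ≥0)) where
  sigmaFinite := inferInstance
  zero := by simp
  finite_compl := by simp
  lintegral_lt_top := by simp

lemma hasLevyRep_zero_iff (μ : Measure (Fin k → ℝ≥0)) (l : Fin k → ℝ≥0) :
    HasLevyRep s μ 0 l ↔ ∀ t, radCharFun s μ t =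
      Real.exp (-(1 * ∑ j, (l j : ℝ) ^ 2 * (t j : ℝ) ^ 2)) := by
  constructor
  · intro h t
    have h1 := h.eq t
    rw [integral_zero_measure, add_zero] at h1
    rw [one_mul]
    exact pos_and_neg_log_eq_iff.1 ⟨h.pos t, h1⟩
  · intro h
    refine ⟨isLevyMeasure_zero, fun t => integrable_zero_measure,
      fun t => (pos_and_neg_log_eq_iff.2 (h t)).1, fun t => ?_⟩
    rw [(pos_and_neg_log_eq_iff.2 (h t)).2, integral_zero_measure, one_mul, add_zero]

end LevyIntegrand

/-! ### Tightness from bounds on the transform. -/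

section Tightness

variable {k : ℕ} {s : ℝ}

/-- Quadratic growth of `t ↦ ∫ (1 - K(t, x)) N(dx)` from its size near the origin. -/
lemma integral_one_sub_kingmanKernelPi_le (hs : -(1 / 2) ≤ s) (N : Measure (Fin k → ℝ≥0))
    [IsFiniteMeasure N] {r₀ : ℝ≥0} (hr₀ : 0 < r₀) {ε : ℝ}
    (h : ∀ j, ∀ r ≤ r₀, ∫ x, (1 - kingmanKernelPi s (Pi.single j r) x) ∂N ≤ ε)
    (t : Fin k → ℝ≥0) :
    ∫ x, (1 - kingmanKernelPi s t x) ∂N ≤ k * ε + 4 * ε / (r₀ : ℝ) ^ 2 * coneNormSq t := by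
  have hint : ∀ t, Integrable (fun x => 1 - kingmanKernelPi s t x) N := fun t =>
    (integrable_const _).sub (integrable_kingmanKernelPi hs N t)
  have hone : ∀ j (r : ℝ≥0), ∫ x, (1 - kingmanKernelPi s (Pi.single j r) x) ∂N ≤
      ε + 4 * ε / (r₀ : ℝ) ^ 2 * (r : ℝ) ^ 2 := by
    intro j r
    have hε : 0 ≤ ε := (integral_nonneg fun x => one_sub_kingmanKernelPi_nonneg hs _ x).trans
      (h j 0 zero_le)
    have hr₀' : (0 : ℝ) < r₀ := hr₀
    rcases le_total r r₀ with hr | hr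
    · refine (h j r hr).trans (le_add_of_nonneg_right (by positivity))
    · have h1 : (1 : ℝ) ≤ r / r₀ := by
        rw [one_le_div hr₀']
        exact hr
      -- With `2^n ≤ r / r₀ < 2^(n+1)`, halving `n + 1` times brings `r` below `r₀`. The duplication
      -- inequality charges `4^(n+1) = 4 (2^n)² ≤ 4 (r / r₀)²`.
      obtain ⟨n, hn1, hn2⟩ := exists_nat_pow_near h1 (one_lt_two)
      have h2 : r / 2 ^ (n + 1) ≤ r₀ := by
        rw [← NNReal.coe_le_coe]
        push_cast
        rw [div_lt_iff₀ hr₀'] at hn2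
        rw [div_le_iff₀ (by positivity)]
        linarith
      have h3 : ∀ x : Fin k → ℝ≥0, 1 - kingmanKernelPi s (Pi.single j r) x ≤
          4 ^ (n + 1) * (1 - kingmanKernelPi s (Pi.single j (r / 2 ^ (n + 1))) x) := by
        intro x
        rw [kingmanKernelPi_single hs, kingmanKernelPi_single hs]
        refine le_trans (le_of_eq ?_) (one_sub_kingmanKernel_two_pow_mul_le hs (n + 1) _)
        congr 2
        push_cast
        field_simp
      calc ∫ x, (1 - kingmanKernelPi s (Pi.single j r) x) ∂N
          ≤ ∫ x, 4 ^ (n + 1) * (1 - kingmanKernelPi s (Pi.single j (r / 2 ^ (n + 1))) x) ∂N :=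
            integral_mono (hint _) ((hint _).const_mul _) h3
        _ = 4 ^ (n + 1) * ∫ x, (1 - kingmanKernelPi s (Pi.single j (r / 2 ^ (n + 1))) x) ∂N :=
            integral_const_mul _ _
        _ ≤ 4 ^ (n + 1) * ε := by
            gcongr
            exact h j _ h2
        _ = 4 * ε * (2 ^ n) ^ 2 := by
            rw [← pow_mul, mul_comm n 2, pow_mul, pow_succ]
            norm_num
            ring
        _ ≤ 4 * ε * ((r : ℝ) / r₀) ^ 2 := by gcongr
        _ = 4 * ε / (r₀ : ℝ) ^ 2 * (r : ℝ) ^ 2 := by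
            field_simp
        _ ≤ _ := le_add_of_nonneg_left hε
  have hint1 : ∀ j ∈ (Finset.univ : Finset (Fin k)),
      Integrable (fun x => 1 - kingmanKernelPi s (Pi.single j (t j)) x) N := fun j _ => hint _
  calc ∫ x, (1 - kingmanKernelPi s t x) ∂N
      ≤ ∫ x, ∑ j, (1 - kingmanKernelPi s (Pi.single j (t j)) x) ∂N := by
        refine integral_mono (hint t) (integrable_finsetSum _ hint1) fun x => ?_
        simp only [kingmanKernelPi_single hs]
        exact one_sub_kingmanKernelPi_le_sum hs t x
    _ = ∑ j, ∫ x, (1 - kingmanKernelPi s (Pi.single j (t j)) x) ∂N := integral_finsetSum _ hint1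
    _ ≤ ∑ j, (ε + 4 * ε / (r₀ : ℝ) ^ 2 * (t j : ℝ) ^ 2) :=
        Finset.sum_le_sum fun j _ => hone j (t j)
    _ = _ := by
        rw [Finset.sum_add_distrib, ← Finset.mul_sum]
        simp [coneNormSq]

/-- Uniform quadratic bounds on `t ↦ ∫ (1 - K(t, x)) N_i(dx)` with arbitrarily small constant
term. -/
def HasUniformQuadraticBound {ι : Type*} (s : ℝ) (N : ι → Measure (Fin k → ℝ≥0)) : Prop :=
  ∀ ε > 0, ∃ C : ℝ, 0 ≤ C ∧ ∀ i t, ∫ x, (1 - kingmanKernelPi s t x) ∂N i ≤ ε + C * coneNormSq t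

/-- A common majorant vanishing at the origin makes the integrals uniformly small on short axis
vectors, and duplication spreads this to all `t`. -/
lemma hasUniformQuadraticBound_of_le {ι : Type*} (hs : -(1 / 2) ≤ s)
    (N : ι → Measure (Fin k → ℝ≥0)) [∀ i, IsFiniteMeasure (N i)] {φ : (Fin k → ℝ≥0) → ℝ}
    (hφ : Tendsto φ (𝓝 0) (𝓝 0))
    (h : ∀ᶠ t in 𝓝 0, ∀ i, ∫ x, (1 - kingmanKernelPi s t x) ∂N i ≤ φ t) :
    HasUniformQuadraticBound s N := by
  intro ε hε
  -- The `k` axes contribute `k * η ≤ ε`; the denominator `k + 1` is never zero.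
  set η : ℝ := ε / (k + 1)
  have hη : 0 < η := by positivity
  have h1 : ∀ᶠ t in 𝓝 (0 : Fin k → ℝ≥0), ∀ i, ∫ x, (1 - kingmanKernelPi s t x) ∂N i ≤ η := by
    filter_upwards [h, hφ.eventually_lt_const hη] with t ht htη i
    exact (ht i).trans htη.le
  have h2 : ∃ r₀ : ℝ≥0, 0 < r₀ ∧ ∀ i j, ∀ r ≤ r₀,
      ∫ x, (1 - kingmanKernelPi s (Pi.single j r) x) ∂N i ≤ η := by
    have h3 : ∀ᶠ r in 𝓝 (0 : ℝ≥0), ∀ j i,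
        ∫ x, (1 - kingmanKernelPi s (Pi.single j r) x) ∂N i ≤ η := by
      rw [eventually_all]
      intro j
      have hc : Tendsto (fun r : ℝ≥0 => (Pi.single j r : Fin k → ℝ≥0)) (𝓝 0) (𝓝 0) := by
        have := (continuous_single (A := fun _ : Fin k => ℝ≥0) j).tendsto 0
        rwa [Pi.single_zero] at this
      exact hc.eventually h1
    obtain ⟨r, hr, hr'⟩ := NNReal.nhds_zero_basis.eventually_iff.1 h3
    refine ⟨r / 2, by positivity, fun i j r' hr'' => hr' ?_ j i⟩
    exact lt_of_le_of_lt hr'' (NNReal.half_lt_self hr.ne')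
  obtain ⟨r₀, hr₀, hr⟩ := h2
  refine ⟨4 * η / (r₀ : ℝ) ^ 2, by positivity, fun i t => ?_⟩
  refine (integral_one_sub_kingmanKernelPi_le hs (N i) hr₀ (hr i) t).trans ?_
  gcongr
  simp only [η]
  rw [mul_div_assoc', div_le_iff₀ (by positivity)]
  nlinarith

/-- The hypothesis averaged over `t` by `gaussMixing s a`, under which `‖t‖²` has mean `4 (s + 1) ∑
a_j`. -/
lemma integral_one_sub_gaussFun_le (hs : -(1 / 2) ≤ s) (N : Measure (Fin k → ℝ≥0))
    [IsFiniteMeasure N] {ε C : ℝ}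
    (h : ∀ t, ∫ x, (1 - kingmanKernelPi s t x) ∂N ≤ ε + C * coneNormSq t) (a : Fin k → ℝ≥0) :
    ∫ x, (1 - gaussFun a x) ∂N ≤ ε + C * (4 * (s + 1) * ∑ j, (a j : ℝ)) := by
  have := isProbabilityMeasure_gaussMixing hs a
  have hR : Integrable (radCharFun s N) (gaussMixing s a) := by
    refine Integrable.of_bound (continuous_radCharFun hs N).aestronglyMeasurable (N.real univ)
      (.of_forall fun t => ?_)
    refine (norm_integral_le_of_norm_le_const (C := 1)
      (.of_forall fun x => abs_kingmanKernelPi_le_one hs t x)).trans (by simp)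
  have h1 : ∫ x, (1 - gaussFun a x) ∂N =
      ∫ t, (N.real univ - radCharFun s N t) ∂gaussMixing s a := by
    rw [integral_sub (integrable_const _) (integrable_gaussFun N a),
      integral_sub (integrable_const _) hR, integral_radCharFun_gaussMixing hs]
    simp
  have hn := integrable_coneNormSq_gaussMixing hs a
  have h2 : ∫ t, coneNormSq t ∂gaussMixing s a = 4 * (s + 1) * ∑ j, (a j : ℝ) := by
    unfold coneNormSq
    rw [integral_finsetSum _ fun j _ => (integral_sq_gaussMixing hs a j).1, Finset.mul_sum]
    exact Finset.sum_congr rfl fun j _ => (integral_sq_gaussMixing hs a j).2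
  rw [h1]
  calc ∫ t, (N.real univ - radCharFun s N t) ∂gaussMixing s a
      ≤ ∫ t, (ε + C * coneNormSq t) ∂gaussMixing s a := by
        refine integral_mono ((integrable_const _).sub hR)
          ((integrable_const _).add (hn.const_mul C)) fun t => ?_
        simp only
        rw [← integral_one_sub_kingmanKernelPi hs]
        exact h t
    _ = _ := by
        rw [integral_add (integrable_const _) (hn.const_mul C), integral_const_mul, h2]
        simp

lemma isCompact_coneNormSq_le (R : ℝ) : IsCompact {x : Fin k → ℝ≥0 | coneNormSq x ≤ R} := by
  refine (isCompact_Icc (a := (0 : Fin k → ℝ≥0)) (b := fun _ => R.toNNReal + 1)).of_isClosed_subset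
    (isClosed_le continuous_coneNormSq continuous_const) fun x hx => ⟨fun j => zero_le,
      fun j => ?_⟩
  have h1 := (sq_le_coneNormSq x j).trans hx
  have h2 : (x j : ℝ) ≤ R + 1 := by nlinarith [sq_nonneg ((x j : ℝ) - 1)]
  rw [← NNReal.coe_le_coe]
  push_cast
  exact h2.trans (by gcongr; exact Real.le_coe_toNNReal R)

/-- For `a = (δ, …, δ)` the function `1 - gaussFun a` is at least `1/2` where `‖x‖² > 1 / δ`, while
its integral is uniformly small for small `δ`; Markov's inequality concludes. -/
lemma HasUniformQuadraticBound.exists_isCompact {ι : Type*} (hs : -(1 / 2) ≤ s)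
    {N : ι → Measure (Fin k → ℝ≥0)} [∀ i, IsFiniteMeasure (N i)]
    (h : HasUniformQuadraticBound s N) {ε : ℝ≥0∞} (hε : 0 < ε) :
    ∃ K : Set (Fin k → ℝ≥0), IsCompact K ∧ 0 ∈ K ∧ ∀ i, N i Kᶜ ≤ ε := by
  rcases eq_top_or_lt_top ε with rfl | hε'
  · exact ⟨{0}, isCompact_singleton, rfl, fun _ => le_top⟩
  lift ε to ℝ≥0 using hε'.ne
  have hε0 : (0 : ℝ) < ε := by exact_mod_cast hε
  have ha : 0 < s + 1 := by linarith
  obtain ⟨C, hC0, hC⟩ := h (ε / 4) (by positivity)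
  set B : ℝ := C * (4 * (s + 1) * k) with hB
  have hB0 : 0 ≤ B := by positivity
  -- This makes the quadratic term at most `ε / 4`. With the constant term `ε / 4` the integral is
  -- at most `ε / 2`, and Markov at level `1/2` doubles it to `ε`.
  set δ : ℝ≥0 := (ε / 4 / (B + 1)).toNNReal with hδ
  have hδ' : (δ : ℝ) = ε / 4 / (B + 1) := Real.coe_toNNReal _ (by positivity)
  have hδ0 : (0 : ℝ) < δ := by rw [hδ']; positivity
  refine ⟨{x | coneNormSq x ≤ 1 / δ}, isCompact_coneNormSq_le _, ?_, fun i => ?_⟩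
  · simp only [mem_ofPred_eq, coneNormSq_zero]
    positivity
  · have h1 := integral_one_sub_gaussFun_le hs (N i) (hC i) fun _ => δ
    have h2 : ∫ x, (1 - gaussFun (fun _ => δ) x) ∂N i ≤ ε / 2 := by
      refine h1.trans ?_
      have h3 : C * (4 * (s + 1) * ∑ _j : Fin k, (δ : ℝ)) = B * δ := by
        simp [hB]
        ring
      have h4 : B * δ ≤ ε / 4 := by
        rw [hδ', mul_div_assoc', div_le_iff₀ (by positivity)]
        nlinarith
      rw [h3]
      linarith
    have hpos : ∀ x : Fin k → ℝ≥0, 0 ≤ 1 - gaussFun (fun _ => δ) x := fun x =>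
      sub_nonneg.2 (gaussFun_le_one _ x)
    have hint : Integrable (fun x => 1 - gaussFun (fun _ => δ) x) (N i) :=
      (integrable_const _).sub (integrable_gaussFun _ _)
    have h5 := mul_meas_ge_le_integral_of_nonneg (.of_forall hpos) hint (1 / 2)
    have h6 : (N i).real {x | coneNormSq x ≤ 1 / δ}ᶜ ≤
        (N i).real {x | 1 / 2 ≤ 1 - gaussFun (fun _ => δ) x} := by
      refine measureReal_mono fun x hx => ?_
      have hx' : 1 / (δ : ℝ) < coneNormSq x := not_le.1 hx
      have h7 : gaussFun (fun _ => δ) x = Real.exp (-(δ * coneNormSq x)) := by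
        unfold gaussFun coneNormSq
        rw [Finset.mul_sum]
      rw [div_lt_iff₀' hδ0] at hx'
      have h8 : Real.exp (-(δ * coneNormSq x)) ≤ 1 / 2 := by
        have h9 := Real.add_one_le_exp (δ * coneNormSq x)
        rw [Real.exp_neg, inv_eq_one_div]
        exact one_div_le_one_div_of_le two_pos (by linarith)
      simp only [mem_ofPred_eq]
      rw [h7]
      linarith
    rw [← ENNReal.ofReal_coe_nnreal, ← ENNReal.ofReal_toReal (measure_ne_top (N i) _)]
    refine ENNReal.ofReal_le_ofReal ?_
    have h10 : (N i {x | coneNormSq x ≤ 1 / δ}ᶜ).toReal =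
      (N i).real {x | coneNormSq x ≤ 1 / δ}ᶜ := rfl
    rw [h10]
    linarith

/-- A tight sequence of probability measures converges weakly along an ultrafilter. -/
lemma exists_tendsto_hyperfilter {E : Type*} [MeasurableSpace E] [TopologicalSpace E] [T2Space E]
    [BorelSpace E] (P : ℕ → Measure E) [∀ n, IsProbabilityMeasure (P n)]
    (hP : ∀ ε : ℝ≥0∞, 0 < ε → ∃ K : Set E, IsCompact K ∧ ∀ n, P n Kᶜ ≤ ε) :
    ∃ Q : Measure E, IsProbabilityMeasure Q ∧ ∀ f : E → ℝ, Continuous f →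
      (∃ C, ∀ x, |f x| ≤ C) →
      Tendsto (fun n => ∫ x, f x ∂P n) (hyperfilter ℕ : Filter ℕ) (𝓝 (∫ x, f x ∂Q)) := by
  let P' : ℕ → ProbabilityMeasure E := fun n => ⟨P n, inferInstance⟩
  have hc : IsCompact (closure (range P')) := by
    refine isCompact_closure_of_isTightMeasureSet
      (isTightMeasureSet_iff_exists_isCompact_measure_compl_le.2 fun ε hε => ?_)
    obtain ⟨K, hK, hK'⟩ := hP ε hε
    refine ⟨K, hK, ?_⟩
    rintro _ ⟨_, ⟨n, rfl⟩, rfl⟩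
    exact hK' n
  -- The image ultrafilter converges in the compact closure, so no subsequence is extracted.
  obtain ⟨Q, -, hQ⟩ := hc.ultrafilter_le_nhds ((hyperfilter ℕ).map P')
    (le_principal_iff.2 (mem_of_superset (Ultrafilter.mem_map.2 (univ_mem' fun n =>
      subset_closure (mem_range_self n))) subset_rfl))
  have hQ' : Tendsto P' (hyperfilter ℕ : Filter ℕ) (𝓝 Q) := hQ
  refine ⟨Q, inferInstance, fun f hf ⟨C, hC⟩ => ?_⟩
  exact (ProbabilityMeasure.tendsto_iff_forall_integral_tendsto.1 hQ')
    (BoundedContinuousFunction.ofNormedAddCommGroup f hf C hC)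

end Tightness

/-! ### Roots, positivity of the transform, and the blow-up. -/

section Representation

variable {k : ℕ} {s : ℝ}

/-! ### Roots of an infinitely divisible law -/

/-- The convolution square of a root of order `2 (n + 1)` is a root of order `n + 1` whose transform
is a square, hence nonnegative. -/
lemma IsKingmanID.exists_nonneg_roots (hs : -(1 / 2) ≤ s) {μ : Measure (Fin k → ℝ≥0)}
    (h : IsKingmanID s μ) : ∃ ν : ℕ → Measure (Fin k → ℝ≥0),
      (∀ n, IsProbabilityMeasure (ν n)) ∧ (∀ n t, 0 ≤ radCharFun s (ν n) t) ∧
        ∀ n t, radCharFun s (ν n) t ^ (n + 1) = radCharFun s μ t := by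
  have h1 : ∀ n : ℕ, ∃ ν : Measure (Fin k → ℝ≥0), IsProbabilityMeasure ν ∧
      (∀ t, 0 ≤ radCharFun s ν t) ∧ ∀ t, radCharFun s ν t ^ (n + 1) = radCharFun s μ t := by
    intro n
    obtain ⟨ρ, hρ, hμ⟩ := h (2 * (n + 1)) (by omega)
    refine ⟨kingmanConv s ρ ρ, isProbabilityMeasure_kingmanConv hs ρ ρ, fun t => ?_, fun t => ?_⟩
    · rw [radCharFun_kingmanConv hs]
      exact mul_self_nonneg _
    · rw [radCharFun_kingmanConv hs, hμ, radCharFun_kingmanPow hs, ← sq, ← pow_mul]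
  choose ν hν using h1
  exact ⟨ν, fun n => (hν n).1, fun n => (hν n).2.1, fun n => (hν n).2.2⟩

lemma natCast_mul_one_sub_le_neg_log {n : ℕ} {y a : ℝ} (ha : 0 < a) (hy : 0 ≤ y)
    (h : y ^ n = a) : n * (1 - y) ≤ -Real.log a := by
  rcases hy.eq_or_lt with rfl | hy
  · rcases Nat.eq_zero_or_pos n with rfl | hn
    · rw [pow_zero] at h
      simp [← h]
    · rw [zero_pow hn.ne'] at h
      exact absurd h ha.ne
  · rw [← h, Real.log_pow]
    have := Real.log_le_sub_one_of_pos hy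
    have hn : (0 : ℝ) ≤ n := by positivity
    nlinarith

/-- Nonnegativity forces `y n = a ^ (1 / (n + 1))`, so the expression is minus a difference quotient
of `r ↦ a ^ r` at `0`. -/
lemma tendsto_natCast_mul_one_sub {y : ℕ → ℝ} {a : ℝ} (ha : 0 < a) (hy : ∀ n, 0 ≤ y n)
    (h : ∀ n, y n ^ (n + 1) = a) :
    Tendsto (fun n : ℕ => ((n + 1 : ℕ) : ℝ) * (1 - y n)) atTop (𝓝 (-Real.log a)) := by
  have hyval : ∀ n : ℕ, y n = Real.exp (Real.log a * (1 / ((n : ℝ) + 1))) := by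
    intro n
    have h1 : (Real.exp (Real.log a * (1 / ((n : ℝ) + 1)))) ^ (n + 1) = a := by
      rw [← Real.exp_nat_mul]
      push_cast
      rw [show ((n : ℝ) + 1) * (Real.log a * (1 / ((n : ℝ) + 1))) = Real.log a by field_simp,
        Real.exp_log ha]
    exact (pow_left_inj₀ (hy n) (Real.exp_pos _).le n.succ_ne_zero).1 ((h n).trans h1.symm)
  have hd : HasDerivAt (fun r : ℝ => Real.exp (Real.log a * r)) (Real.log a) 0 := by
    have := ((hasDerivAt_id (0 : ℝ)).const_mul (Real.log a)).exp
    simpa using this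
  have h2 := hd.tendsto_slope_zero_right.comp
    (tendsto_nhdsWithin_iff.2 ⟨tendsto_one_div_add_atTop_nhds_zero_nat (𝕜 := ℝ),
      .of_forall fun n => mem_Ioi.2 (by positivity)⟩)
  refine h2.neg.congr fun n => ?_
  simp only [Function.comp_apply, zero_add, mul_zero, Real.exp_zero, smul_eq_mul]
  rw [← hyval]
  push_cast
  field_simp
  ring

lemma tendsto_neg_log_radCharFun (hs : -(1 / 2) ≤ s) (μ : Measure (Fin k → ℝ≥0))
    [IsProbabilityMeasure μ] :
    Tendsto (fun t => -Real.log (radCharFun s μ t)) (𝓝 0) (𝓝 0) := by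
  have h0 : radCharFun s μ 0 = 1 := by simp [radCharFun_zero hs]
  have h1 := (continuous_radCharFun hs μ).tendsto 0
  rw [h0] at h1
  have h2 := (h1.log one_ne_zero).neg
  simpa using h2

lemma integral_one_sub_natCast_smul (hs : -(1 / 2) ≤ s) (ν : Measure (Fin k → ℝ≥0))
    [IsProbabilityMeasure ν] (n : ℕ) (t : Fin k → ℝ≥0) :
    ∫ x, (1 - kingmanKernelPi s t x) ∂((n : ℝ≥0) • ν) = n * (1 - radCharFun s ν t) := by
  rw [integral_smul_nnreal_measure, integral_one_sub_kingmanKernelPi hs]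
  simp [NNReal.smul_def]

/-- Near the origin `μ̂ > 0` by continuity, and there `-log μ̂` is a majorant common to all `n`. -/
lemma hasUniformQuadraticBound_roots (hs : -(1 / 2) ≤ s) {μ : Measure (Fin k → ℝ≥0)}
    [IsProbabilityMeasure μ] {ν : ℕ → Measure (Fin k → ℝ≥0)} [∀ n, IsProbabilityMeasure (ν n)]
    (h0 : ∀ n t, 0 ≤ radCharFun s (ν n) t)
    (h : ∀ n t, radCharFun s (ν n) t ^ (n + 1) = radCharFun s μ t) :
    HasUniformQuadraticBound s fun n => ((n + 1 : ℕ) : ℝ≥0) • ν n := by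
  refine hasUniformQuadraticBound_of_le hs _ (tendsto_neg_log_radCharFun hs μ) ?_
  have h1 := (continuous_radCharFun hs μ).tendsto 0
  rw [radCharFun_zero hs] at h1
  simp only [probReal_univ] at h1
  filter_upwards [h1.eventually_const_lt one_pos] with t ht n
  rw [integral_one_sub_natCast_smul hs]
  exact natCast_mul_one_sub_le_neg_log ht (h0 n t) (h n t)

/-- A zero of `μ̂` at `t` would be a zero of every `ν̂_n`, so `n + 1` would stay below the quadratic
bound at `t` for all `n`. -/
lemma radCharFun_pos_of_roots (hs : -(1 / 2) ≤ s) {μ : Measure (Fin k → ℝ≥0)}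
    [IsProbabilityMeasure μ] {ν : ℕ → Measure (Fin k → ℝ≥0)} [∀ n, IsProbabilityMeasure (ν n)]
    (h0 : ∀ n t, 0 ≤ radCharFun s (ν n) t)
    (h : ∀ n t, radCharFun s (ν n) t ^ (n + 1) = radCharFun s μ t) (t : Fin k → ℝ≥0) :
    0 < radCharFun s μ t := by
  obtain ⟨C, -, hC⟩ := hasUniformQuadraticBound_roots hs h0 h 1 one_pos
  obtain ⟨n, hn⟩ := exists_nat_gt (1 + C * coneNormSq t)
  have h1 := hC n t
  rw [integral_one_sub_natCast_smul hs] at h1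
  rw [← h n t]
  refine pow_pos ((h0 n t).lt_of_ne fun h2 => ?_) _
  rw [← h2] at h1
  push_cast at h1
  linarith

/-! ### The blow-up of the cone at the origin -/

/-- The squared direction cosines `x_j² / ‖x‖²`. -/
noncomputable def coneDirection (x : Fin k → ℝ≥0) (j : Fin k) : unitInterval :=
  ⟨(x j : ℝ) ^ 2 / coneNormSq x, div_nonneg (sq_nonneg _) (coneNormSq_nonneg x),
    div_le_one_of_le₀ (sq_le_coneNormSq x j) (coneNormSq_nonneg x)⟩

lemma measurable_coneDirection : Measurable (coneDirection (k := k)) := by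
  have h2 := (continuous_coneNormSq (k := k)).measurable
  refine measurable_pi_lambda _ fun j => Measurable.subtype_mk ?_
  fun_prop

/-- The part of `levyIntegrand` which is continuous at the origin. -/
noncomputable def levyRemainder (s : ℝ) (t x : Fin k → ℝ≥0) : ℝ :=
  levyIntegrand s t x - ∑ j, (t j : ℝ) ^ 2 / (4 * (s + 1)) * (coneDirection x j : ℝ)

lemma sum_coneDirection_eq (s : ℝ) (t x : Fin k → ℝ≥0) :
    ∑ j, (t j : ℝ) ^ 2 / (4 * (s + 1)) * (coneDirection x j : ℝ) =
      (∑ j, (t j : ℝ) ^ 2 * (x j : ℝ) ^ 2 / (4 * (s + 1))) / coneNormSq x := by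
  rw [Finset.sum_div]
  refine Finset.sum_congr rfl fun j _ => ?_
  simp only [coneDirection]
  ring

lemma levyIntegrand_zero (hs : -(1 / 2) ≤ s) (t : Fin k → ℝ≥0) : levyIntegrand s t 0 = 0 := by
  simp [levyIntegrand, kingmanKernelPi_zero_right hs]

lemma levyRemainder_zero (hs : -(1 / 2) ≤ s) (t : Fin k → ℝ≥0) : levyRemainder s t 0 = 0 := by
  simp [levyRemainder, levyIntegrand_zero hs, coneDirection]

/-- With `S = ∑ t_j² x_j² / (4 (s + 1))`, off the origin the remainder is `(1 - K) - (K - (1 - S)) /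
‖x‖²`, and both terms tend to `0` at the origin by the second-order expansion. -/
lemma continuous_levyRemainder (hs : -(1 / 2) ≤ s) (t : Fin k → ℝ≥0) :
    Continuous (levyRemainder s t) := by
  have hK := continuous_kingmanKernelPi hs t
  have hn := continuous_coneNormSq (k := k)
  rw [continuous_iff_continuousAt]
  intro x
  by_cases hx : x = 0
  · subst hx
    have h1 := (kingmanKernelPi_sub_isLittleO hs t).tendsto_div_nhds_zero
    have h2 : Tendsto (fun x => 1 - kingmanKernelPi s t x) (𝓝 0) (𝓝 0) := by
      have hc : Continuous fun x => 1 - kingmanKernelPi s t x := continuous_const.sub hK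
      have := hc.tendsto 0
      simpa [kingmanKernelPi_zero_right hs] using this
    have h3 := h2.sub h1
    rw [ContinuousAt, levyRemainder_zero hs]
    rw [sub_zero] at h3
    refine h3.congr fun x => ?_
    by_cases hx : x = 0
    · subst hx
      simp [levyRemainder_zero hs, kingmanKernelPi_zero_right hs]
    · have := (coneNormSq_pos hx).ne'
      simp only [levyRemainder, sum_coneDirection_eq, levyIntegrand]
      field_simp
      ring
  · have h0 := (coneNormSq_pos hx).ne'
    have e : levyRemainder s t = fun x =>
        (1 - kingmanKernelPi s t x) * ((1 + coneNormSq x) / coneNormSq x) -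
          (∑ j, (t j : ℝ) ^ 2 * (x j : ℝ) ^ 2 / (4 * (s + 1))) / coneNormSq x := by
      funext x
      rw [levyRemainder, sum_coneDirection_eq, levyIntegrand]
    rw [e]
    have := hK.continuousAt (x := x)
    have := hn.continuousAt (x := x)
    refine ContinuousAt.sub (ContinuousAt.mul (by fun_prop) (ContinuousAt.div (by fun_prop)
      (by fun_prop) h0)) (ContinuousAt.div (Continuous.continuousAt (by fun_prop))
      (by fun_prop) h0)

/-- The extension of `levyIntegrand` to the blow-up. -/
noncomputable def levyBlowup (s : ℝ) (t : Fin k → ℝ≥0)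
    (p : (Fin k → ℝ≥0) × (Fin k → unitInterval)) : ℝ :=
  levyRemainder s t p.1 + ∑ j, (t j : ℝ) ^ 2 / (4 * (s + 1)) * (p.2 j : ℝ)

lemma continuous_levyBlowup (hs : -(1 / 2) ≤ s) (t : Fin k → ℝ≥0) :
    Continuous (levyBlowup s t) := by
  have h := continuous_levyRemainder hs t
  unfold levyBlowup
  fun_prop

lemma levyBlowup_coneDirection (s : ℝ) (t x : Fin k → ℝ≥0) :
    levyBlowup s t (x, coneDirection x) = levyIntegrand s t x := by
  simp [levyBlowup, levyRemainder]

lemma abs_sum_mul_unitInterval_le (hs : -(1 / 2) ≤ s) (t : Fin k → ℝ≥0)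
    (d : Fin k → unitInterval) :
    |∑ j, (t j : ℝ) ^ 2 / (4 * (s + 1)) * (d j : ℝ)| ≤ coneNormSq t := by
  have ha : 0 < s + 1 := by linarith
  rw [abs_of_nonneg (Finset.sum_nonneg fun j _ => mul_nonneg (by positivity) (d j).2.1)]
  unfold coneNormSq
  refine Finset.sum_le_sum fun j _ => ?_
  calc (t j : ℝ) ^ 2 / (4 * (s + 1)) * (d j : ℝ) ≤ (t j : ℝ) ^ 2 / (4 * (s + 1)) :=
        mul_le_of_le_one_right (by positivity) (d j).2.2
    _ ≤ (t j : ℝ) ^ 2 := div_le_self (sq_nonneg _) (by linarith)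

lemma abs_levyBlowup_le (hs : -(1 / 2) ≤ s) (t : Fin k → ℝ≥0)
    (p : (Fin k → ℝ≥0) × (Fin k → unitInterval)) :
    |levyBlowup s t p| ≤ 2 + 3 * coneNormSq t := by
  have h1 := abs_le.1 (abs_sum_mul_unitInterval_le hs t p.2)
  have h2 := abs_le.1 (abs_sum_mul_unitInterval_le hs t (coneDirection p.1))
  have h3 := levyIntegrand_nonneg hs t p.1
  have h4 := levyIntegrand_le hs t p.1
  unfold levyBlowup levyRemainder
  rw [abs_le]
  constructor <;> linarith

lemma levyBlowup_zero_left (hs : -(1 / 2) ≤ s) (t : Fin k → ℝ≥0) (d : Fin k → unitInterval) :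
    levyBlowup s t (0, d) = ∑ j, (t j : ℝ) ^ 2 / (4 * (s + 1)) * (d j : ℝ) := by
  simp [levyBlowup, levyRemainder_zero hs]

/-- The defect of the relation `d_j ‖x‖² = x_j²` in the blow-up. -/
noncomputable def blowupDefect (p : (Fin k → ℝ≥0) × (Fin k → unitInterval)) : ℝ :=
  min 1 (∑ j, |(p.2 j : ℝ) * coneNormSq p.1 - (p.1 j : ℝ) ^ 2|)

lemma continuous_blowupDefect : Continuous (blowupDefect (k := k)) := by
  have hn := continuous_coneNormSq (k := k)
  unfold blowupDefect
  fun_prop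

lemma blowupDefect_nonneg (p : (Fin k → ℝ≥0) × (Fin k → unitInterval)) : 0 ≤ blowupDefect p :=
  le_min zero_le_one (Finset.sum_nonneg fun _ _ => abs_nonneg _)

lemma blowupDefect_coneDirection (x : Fin k → ℝ≥0) : blowupDefect (x, coneDirection x) = 0 := by
  unfold blowupDefect
  have : ∀ j, (coneDirection x j : ℝ) * coneNormSq x - (x j : ℝ) ^ 2 = 0 := by
    intro j
    by_cases hx : x = 0
    · subst hx
      simp [coneNormSq_zero]
    · have := (coneNormSq_pos hx).ne'
      simp only [coneDirection]
      field_simp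
      ring
  simp [this]

lemma eq_coneDirection_of_blowupDefect {x : Fin k → ℝ≥0} (hx : x ≠ 0) {d : Fin k → unitInterval}
    (h : blowupDefect (x, d) = 0) : d = coneDirection x := by
  have hn := coneNormSq_pos hx
  have h1 : ∑ j, |(d j : ℝ) * coneNormSq x - (x j : ℝ) ^ 2| = 0 := by
    unfold blowupDefect at h
    rcases min_choice (1 : ℝ) (∑ j, |(d j : ℝ) * coneNormSq x - (x j : ℝ) ^ 2|) with h2 | h2
    · rw [h2] at h
      exact absurd h one_ne_zero
    · rw [h2] at h
      exact h
  funext j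
  have h3 := (Finset.sum_eq_zero_iff_of_nonneg fun _ _ => abs_nonneg _).1 h1 j (Finset.mem_univ j)
  rw [abs_eq_zero, sub_eq_zero] at h3
  ext
  simp only [coneDirection]
  rw [← h3]
  field_simp

/-- Lévy-Khinchine exponents are the integrals of `levyBlowup` over the blow-up. -/
lemma exists_rep_of_blowup (hs : -(1 / 2) ≤ s)
    (Q : Measure ((Fin k → ℝ≥0) × (Fin k → unitInterval))) [IsFiniteMeasure Q]
    (hQ : ∫ p, blowupDefect p ∂Q = 0) :
    ∃ (M : Measure (Fin k → ℝ≥0)) (l : Fin k → ℝ≥0), IsFiniteMeasure M ∧ M {0} = 0 ∧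
      ∀ t, ∫ p, levyBlowup s t p ∂Q =
        ∑ j, (l j : ℝ) ^ 2 * (t j : ℝ) ^ 2 + ∫ x, levyIntegrand s t x ∂M := by
  have ha : 0 < s + 1 := by linarith
  set A : Set ((Fin k → ℝ≥0) × (Fin k → unitInterval)) := {p | p.1 = 0} with hA
  have hAm : MeasurableSet A := measurable_fst (measurableSet_singleton 0)
  have hd : ∀ (j : Fin k), Integrable
      (fun p : (Fin k → ℝ≥0) × (Fin k → unitInterval) => (p.2 j : ℝ)) (Q.restrict A) := by
    intro j
    refine Integrable.of_bound (Continuous.aestronglyMeasurable (by fun_prop)) 1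
      (.of_forall fun p => ?_)
    rw [Real.norm_of_nonneg (p.2 j).2.1]
    exact (p.2 j).2.2
  have hae : ∀ᵐ p ∂Q, blowupDefect p = 0 := by
    refine (integral_eq_zero_iff_of_nonneg blowupDefect_nonneg ?_).1 hQ
    refine Integrable.of_bound continuous_blowupDefect.aestronglyMeasurable 1
      (.of_forall fun p => ?_)
    rw [Real.norm_of_nonneg (blowupDefect_nonneg p)]
    exact min_le_left _ _
  -- `M` is the part of `Q` off the fibre over the origin, projected to the cone. On the fibre the
  -- integrand is linear in the direction, so only the integrals of the `d_j` matter, and they give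
  -- `l_j²`.
  refine ⟨(Q.restrict Aᶜ).map Prod.fst,
    fun j => NNReal.sqrt ((∫ p in A, (p.2 j : ℝ) ∂Q) / (4 * (s + 1))).toNNReal,
    inferInstance, ?_, fun t => ?_⟩
  · rw [Measure.map_apply measurable_fst (measurableSet_singleton 0),
      Measure.restrict_apply (measurable_fst (measurableSet_singleton 0))]
    have : Prod.fst ⁻¹' {0} ∩ Aᶜ = ∅ := by
      ext p
      simp [hA]
    rw [this, measure_empty]
  · have hint : Integrable (levyBlowup s t) Q :=
      Integrable.of_bound (continuous_levyBlowup hs t).aestronglyMeasurable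
        (2 + 3 * coneNormSq t) (.of_forall fun p => abs_levyBlowup_le hs t p)
    rw [← integral_add_compl hAm hint]
    congr 1
    · have h1 : ∀ p ∈ A, levyBlowup s t p =
          ∑ j, (t j : ℝ) ^ 2 / (4 * (s + 1)) * (p.2 j : ℝ) := by
        rintro ⟨x, d⟩ hp
        have hx : x = 0 := hp
        rw [hx, levyBlowup_zero_left hs]
      rw [setIntegral_congr_fun hAm h1, integral_finsetSum _ fun j _ => (hd j).const_mul _]
      refine Finset.sum_congr rfl fun j _ => ?_
      have h2 : 0 ≤ ∫ p in A, (p.2 j : ℝ) ∂Q := integral_nonneg fun p => (p.2 j).2.1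
      rw [integral_const_mul, Real.coe_sqrt, Real.sq_sqrt (NNReal.coe_nonneg _),
        Real.coe_toNNReal _ (by positivity)]
      ring
    · rw [integral_map measurable_fst.aemeasurable
        (measurable_levyIntegrand hs t).aestronglyMeasurable]
      refine setIntegral_congr_ae hAm.compl ?_
      filter_upwards [hae] with p hp hpA
      obtain ⟨x, d⟩ := p
      -- Off the origin, zero defect puts `Q` on the graph of the direction, where the extension is
      -- the original integrand.
      rw [eq_coneDirection_of_blowupDefect hpA hp, levyBlowup_coneDirection]

end Representation

/-! ### Existence of the representation. -/

section Representation

variable {k : ℕ} {s : ℝ}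

/-- The weight `‖x‖² / (1 + ‖x‖²)`. -/
noncomputable def coneWeight (x : Fin k → ℝ≥0) : ℝ := coneNormSq x / (1 + coneNormSq x)

lemma continuous_coneWeight : Continuous (coneWeight (k := k)) := by
  have hn := continuous_coneNormSq (k := k)
  unfold coneWeight
  exact hn.div (by fun_prop) fun x => by linarith [coneNormSq_nonneg x]

lemma coneWeight_nonneg (x : Fin k → ℝ≥0) : 0 ≤ coneWeight x :=
  div_nonneg (coneNormSq_nonneg x) (by linarith [coneNormSq_nonneg x])

lemma coneWeight_le_one (x : Fin k → ℝ≥0) : coneWeight x ≤ 1 :=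
  div_le_one_of_le₀ (by linarith) (by linarith [coneNormSq_nonneg x])

/-- `exp (-r) ≤ 1 / (1 + r)` at `r = ‖x‖²`. It bounds the weighted mass by a Gaussian average. -/
lemma coneWeight_le_one_sub_gaussFun (x : Fin k → ℝ≥0) : coneWeight x ≤ 1 - gaussFun 1 x := by
  have hn := coneNormSq_nonneg x
  have h1 : gaussFun 1 x ≤ 1 / (1 + coneNormSq x) := by
    rw [gaussFun_one, Real.exp_neg, inv_eq_one_div]
    exact one_div_le_one_div_of_le (by linarith) (by linarith [Real.add_one_le_exp (coneNormSq x)])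
  have h2 : coneWeight x = 1 - 1 / (1 + coneNormSq x) := by
    unfold coneWeight
    field_simp
    ring
  linarith

lemma coneWeight_mul_levyIntegrand (hs : -(1 / 2) ≤ s) (t x : Fin k → ℝ≥0) :
    coneWeight x * levyIntegrand s t x = 1 - kingmanKernelPi s t x := by
  by_cases hx : x = 0
  · subst hx
    simp [levyIntegrand_zero hs, kingmanKernelPi_zero_right hs]
  · have hn := coneNormSq_pos hx
    unfold coneWeight levyIntegrand
    field_simp

lemma isLevyMeasure_of_isFiniteMeasure (M : Measure (Fin k → ℝ≥0)) [IsFiniteMeasure M]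
    (h : M {0} = 0) : IsLevyMeasure M where
  sigmaFinite := inferInstance
  zero := h
  finite_compl := fun _ _ => measure_lt_top _ _
  lintegral_lt_top := by
    refine (lintegral_mono (g := fun _ => 1) fun x => ?_).trans_lt
      (by simp : ∫⁻ _, 1 ∂M < ∞)
    exact ENNReal.ofReal_le_one.2 (coneWeight_le_one x)

/-- The image of the weighted measure `‖x‖² / (1 + ‖x‖²) N(dx)` in the blow-up, scaled by `c⁻¹` and
completed by an atom to total mass one. -/
noncomputable def blowupLaw (c : ℝ≥0) (N : Measure (Fin k → ℝ≥0)) :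
    Measure ((Fin k → ℝ≥0) × (Fin k → unitInterval)) :=
  c⁻¹ • (N.withDensity fun x => ENNReal.ofReal (coneWeight x)).map (fun x => (x, coneDirection x)) +
    (1 - c⁻¹ * ((N.withDensity fun x => ENNReal.ofReal (coneWeight x)) univ).toNNReal) •
      Measure.dirac (0, 0)

lemma measurable_ofReal_coneWeight :
    Measurable fun x : Fin k → ℝ≥0 => ENNReal.ofReal (coneWeight x) :=
  continuous_coneWeight.measurable.ennreal_ofReal

lemma measurable_prodMk_coneDirection :
    Measurable fun x : Fin k → ℝ≥0 => (x, coneDirection x) :=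
  measurable_id.prodMk measurable_coneDirection

lemma withDensity_coneWeight_le (N : Measure (Fin k → ℝ≥0)) :
    (N.withDensity fun x => ENNReal.ofReal (coneWeight x)) ≤ N := by
  calc (N.withDensity fun x => ENNReal.ofReal (coneWeight x)) ≤ N.withDensity 1 :=
        withDensity_mono (.of_forall fun x => ENNReal.ofReal_le_one.2 (coneWeight_le_one x))
    _ = N := withDensity_one

lemma isFiniteMeasure_withDensity_coneWeight (N : Measure (Fin k → ℝ≥0)) [IsFiniteMeasure N] :
    IsFiniteMeasure (N.withDensity fun x => ENNReal.ofReal (coneWeight x)) :=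
  isFiniteMeasure_of_le N (withDensity_coneWeight_le N)

lemma isProbabilityMeasure_blowupLaw {c : ℝ≥0} (hc : 1 ≤ c) (N : Measure (Fin k → ℝ≥0))
    [IsFiniteMeasure N]
    (h : (N.withDensity fun x => ENNReal.ofReal (coneWeight x)) univ ≤ c) :
    IsProbabilityMeasure (blowupLaw c N) := by
  have := isFiniteMeasure_withDensity_coneWeight N
  set G := N.withDensity fun x => ENNReal.ofReal (coneWeight x) with hG
  have hc0 : 0 < c := lt_of_lt_of_le one_pos hc
  have hm : ((G univ).toNNReal : ℝ≥0∞) = G univ := ENNReal.coe_toNNReal (measure_ne_top _ _)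
  -- Ensures that the truncated subtraction in the mass of the atom is a true one.
  have hle : c⁻¹ * (G univ).toNNReal ≤ 1 := by
    rw [inv_mul_le_iff₀ hc0, mul_one, ← ENNReal.coe_le_coe, hm]
    exact h
  constructor
  unfold blowupLaw
  rw [← hG, Measure.add_apply, Measure.smul_apply, Measure.smul_apply,
    Measure.map_apply measurable_prodMk_coneDirection MeasurableSet.univ, preimage_univ,
    Measure.dirac_apply_of_mem (mem_univ _), ← hm, ENNReal.smul_def, ENNReal.smul_def, smul_eq_mul, smul_eq_mul, mul_one,
    ← ENNReal.coe_mul, ← ENNReal.coe_add, ENNReal.toNNReal_coe, add_tsub_cancel_of_le hle]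
  rfl

/-- The condition `f (0, 0) = 0` makes the completing atom invisible; the test functions used below
satisfy it. -/
lemma integral_blowupLaw (c : ℝ≥0) (N : Measure (Fin k → ℝ≥0)) [IsFiniteMeasure N]
    {f : (Fin k → ℝ≥0) × (Fin k → unitInterval) → ℝ} (hf : Continuous f) {B : ℝ}
    (hB : ∀ p, |f p| ≤ B) (h0 : f (0, 0) = 0) :
    ∫ p, f p ∂blowupLaw c N = (c : ℝ)⁻¹ * ∫ x, coneWeight x * f (x, coneDirection x) ∂N := by
  have := isFiniteMeasure_withDensity_coneWeight N
  have hint : ∀ (m : Measure ((Fin k → ℝ≥0) × (Fin k → unitInterval))), IsFiniteMeasure m →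
      Integrable f m := fun m _ => Integrable.of_bound hf.aestronglyMeasurable B (.of_forall hB)
  unfold blowupLaw
  rw [integral_add_measure (hint _ inferInstance) (hint _ inferInstance),
    integral_smul_nnreal_measure, integral_smul_nnreal_measure, integral_dirac, h0, smul_zero,
    add_zero, integral_map measurable_prodMk_coneDirection.aemeasurable hf.aestronglyMeasurable,
    integral_withDensity_eq_integral_toReal_smul measurable_ofReal_coneWeight (by simp)]
  simp only [ENNReal.toReal_ofReal (coneWeight_nonneg _), smul_eq_mul, NNReal.smul_def,
    NNReal.coe_inv]

/-- The blown-up, weighted measures `(n + 1) ν_n` have a weak limit. Testing it with the extended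
integrand gives `-log μ̂`, and testing it with the defect shows that it comes from a pair `[M, l]`.
-/
theorem IsKingmanID.exists_hasLevyRep (hs : -(1 / 2) ≤ s) {μ : Measure (Fin k → ℝ≥0)}
    [IsProbabilityMeasure μ] (h : IsKingmanID s μ) : ∃ M l, HasLevyRep s μ M l := by
  have ha : 0 < s + 1 := by linarith
  obtain ⟨ν, hν, h0, hroot⟩ := h.exists_nonneg_roots hs
  have hpos := radCharFun_pos_of_roots hs h0 hroot
  have hquad := hasUniformQuadraticBound_roots hs h0 hroot
  set N : ℕ → Measure (Fin k → ℝ≥0) := fun n => ((n + 1 : ℕ) : ℝ≥0) • ν n with hN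
  have hNfin : ∀ n, IsFiniteMeasure (N n) := fun n => by
    simp only [hN]
    infer_instance
  obtain ⟨C, hC0, hC⟩ := hquad 1 one_pos
  -- The bound of `integral_one_sub_gaussFun_le` at `a = 1` with constant term `1`; it dominates the
  -- weighted mass for every `n`.
  set B : ℝ := 1 + C * (4 * (s + 1) * ∑ j : Fin k, ((1 : Fin k → ℝ≥0) j : ℝ)) with hB
  have hB1 : 1 ≤ B := by
    rw [hB]
    have : 0 ≤ ∑ j : Fin k, ((1 : Fin k → ℝ≥0) j : ℝ) := by positivity
    exact le_add_of_nonneg_right (by positivity)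
  set c : ℝ≥0 := B.toNNReal with hc
  have hc1 : 1 ≤ c := by
    rw [hc, ← Real.toNNReal_one]
    exact Real.toNNReal_le_toNNReal hB1
  have hcpos : (0 : ℝ) < c := lt_of_lt_of_le one_pos (by exact_mod_cast hc1)
  have hmass : ∀ n, ((N n).withDensity fun x => ENNReal.ofReal (coneWeight x)) univ ≤ c := by
    intro n
    rw [withDensity_apply _ MeasurableSet.univ, Measure.restrict_univ,
      ← ofReal_integral_eq_lintegral_ofReal _ (.of_forall coneWeight_nonneg)]
    · refine ENNReal.ofReal_le_ofReal (le_trans ?_ (integral_one_sub_gaussFun_le hs (N n) (hC n) 1))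
      refine integral_mono ?_ ((integrable_const _).sub (integrable_gaussFun _ _))
        coneWeight_le_one_sub_gaussFun
      exact Integrable.of_bound continuous_coneWeight.aestronglyMeasurable 1 (.of_forall fun x => by
        rw [Real.norm_of_nonneg (coneWeight_nonneg x)]
        exact coneWeight_le_one x)
    · exact Integrable.of_bound continuous_coneWeight.aestronglyMeasurable 1 (.of_forall fun x => by
        rw [Real.norm_of_nonneg (coneWeight_nonneg x)]
        exact coneWeight_le_one x)
  have hP := fun n => isProbabilityMeasure_blowupLaw hc1 (N n) (hmass n)
  have htight : ∀ ε : ℝ≥0∞, 0 < ε → ∃ K : Set ((Fin k → ℝ≥0) × (Fin k → unitInterval)),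
      IsCompact K ∧ ∀ n, blowupLaw c (N n) Kᶜ ≤ ε := by
    intro ε hε
    obtain ⟨K, hK, hK0, hKN⟩ := hquad.exists_isCompact hs hε
    -- The direction cube is compact, and `0 ∈ K` keeps the completing atom inside.
    refine ⟨K ×ˢ univ, hK.prod isCompact_univ, fun n => ?_⟩
    have hKm : MeasurableSet (K ×ˢ (univ : Set (Fin k → unitInterval)))ᶜ :=
      (hK.measurableSet.prod MeasurableSet.univ).compl
    unfold blowupLaw
    rw [Measure.add_apply, Measure.smul_apply, Measure.smul_apply,
      Measure.map_apply measurable_prodMk_coneDirection hKm, Measure.dirac_apply' _ hKm]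
    have h1 : (fun x : Fin k → ℝ≥0 => (x, coneDirection x)) ⁻¹'
        (K ×ˢ (univ : Set (Fin k → unitInterval)))ᶜ = Kᶜ := by
      ext x
      simp
    rw [h1, indicator_of_notMem (by simp [hK0]), smul_zero, add_zero]
    calc c⁻¹ • ((N n).withDensity fun x => ENNReal.ofReal (coneWeight x)) Kᶜ
        ≤ c⁻¹ • (N n) Kᶜ := by
          gcongr
          exact withDensity_coneWeight_le (N n)
      _ ≤ N n Kᶜ := by
          rw [ENNReal.smul_def, smul_eq_mul]
          exact mul_le_of_le_one_left zero_le (by exact_mod_cast inv_le_one_of_one_le₀ hc1)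
      _ ≤ ε := hKN n
  obtain ⟨Q, hQ, hlim⟩ := exists_tendsto_hyperfilter (fun n => blowupLaw c (N n)) htight
  have hdef : ∫ p, blowupDefect p ∂Q = 0 := by
    have hb : ∀ p : (Fin k → ℝ≥0) × (Fin k → unitInterval), |blowupDefect p| ≤ 1 := fun p => by
      rw [abs_of_nonneg (blowupDefect_nonneg p)]
      exact min_le_left _ _
    -- The truncation at `1` makes the defect a bounded test function, so its vanishing passes to
    -- the limit.
    have h1 := hlim blowupDefect continuous_blowupDefect ⟨1, hb⟩
    have h2 : blowupDefect ((0 : Fin k → ℝ≥0), (0 : Fin k → unitInterval)) = 0 := by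
      simp [blowupDefect]
    have h3 : ∀ n, ∫ p, blowupDefect p ∂blowupLaw c (N n) = 0 := by
      intro n
      rw [integral_blowupLaw c (N n) continuous_blowupDefect hb h2]
      simp [blowupDefect_coneDirection]
    simp only [h3] at h1
    exact (tendsto_nhds_unique h1 tendsto_const_nhds)
  have hexp : ∀ t, -Real.log (radCharFun s μ t) = c * ∫ p, levyBlowup s t p ∂Q := by
    intro t
    have h1 := hlim (levyBlowup s t) (continuous_levyBlowup hs t)
      ⟨_, abs_levyBlowup_le hs t⟩
    have h2 : levyBlowup s t (0, 0) = 0 := by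
      rw [levyBlowup_zero_left hs]
      simp
    have h3 : ∀ n, ∫ p, levyBlowup s t p ∂blowupLaw c (N n) =
        (c : ℝ)⁻¹ * (((n + 1 : ℕ) : ℝ) * (1 - radCharFun s (ν n) t)) := by
      intro n
      rw [integral_blowupLaw c (N n) (continuous_levyBlowup hs t) (abs_levyBlowup_le hs t) h2]
      simp only [levyBlowup_coneDirection, coneWeight_mul_levyIntegrand hs]
      rw [integral_one_sub_natCast_smul hs]
    simp only [h3] at h1
    have h4 := ((tendsto_natCast_mul_one_sub (hpos t) (fun n => h0 n t)
      (fun n => hroot n t)).const_mul (c : ℝ)⁻¹).mono_left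
        (Nat.hyperfilter_le_atTop)
    rw [tendsto_nhds_unique h1 h4]
    field_simp
  have : IsFiniteMeasure Q := inferInstance
  have hcQ : ∫ p, blowupDefect p ∂(c • Q) = 0 := by
    rw [integral_smul_nnreal_measure, hdef, smul_zero]
  obtain ⟨M, l, hM, hM0, hrep⟩ := exists_rep_of_blowup hs (c • Q) hcQ
  refine ⟨M, l, isLevyMeasure_of_isFiniteMeasure M hM0, integrable_levyIntegrand hs M, hpos,
    fun t => ?_⟩
  rw [← hrep t, hexp t, integral_smul_nnreal_measure, NNReal.smul_def, smul_eq_mul]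

/-! ### Laws with a given exponent -/

lemma radCharFun_sum (hs : -(1 / 2) ≤ s) (N : ℕ → Measure (Fin k → ℝ≥0))
    [IsFiniteMeasure (Measure.sum N)] (t : Fin k → ℝ≥0) :
    HasSum (fun n => radCharFun s (N n) t) (radCharFun s (Measure.sum N) t) :=
  hasSum_integral_measure (integrable_kingmanKernelPi hs _ t)

/-- The compound Poisson law with intensity `N`. -/
lemma exists_compoundPoisson (hs : -(1 / 2) ≤ s) (N : Measure (Fin k → ℝ≥0)) [IsFiniteMeasure N] :
    ∃ π : Measure (Fin k → ℝ≥0), IsProbabilityMeasure π ∧ ∀ t, radCharFun s π t =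
      Real.exp (-∫ x, (1 - kingmanKernelPi s t x) ∂N) := by
  set m : ℝ := N.real univ with hm
  -- Poisson weights without `m^n`: the powers of the unnormalized `N` carry that mass.
  set p : ℕ → ℝ≥0 := fun n => (Real.exp (-m) / (n.factorial : ℝ)).toNNReal with hp
  have hpr : ∀ n, (p n : ℝ) = Real.exp (-m) / (n.factorial : ℝ) := fun n =>
    Real.coe_toNNReal _ (by positivity)
  have hexp : ∀ y : ℝ, HasSum (fun n => (p n : ℝ) * y ^ n) (Real.exp (-m) * Real.exp y) := by
    intro y
    have h1 : HasSum (fun n : ℕ => y ^ n / (n.factorial : ℝ)) (Real.exp y) := by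
      rw [Real.exp_eq_exp_ℝ]
      exact NormedSpace.expSeries_div_hasSum_exp y
    refine (h1.mul_left (Real.exp (-m))).congr_fun fun n => ?_
    rw [hpr]
    ring
  set π : Measure (Fin k → ℝ≥0) := Measure.sum fun n => p n • kingmanPow s N n with hπ
  have hfin := fun n => isFiniteMeasure_kingmanPow hs N n
  have hprob : IsProbabilityMeasure π := by
    constructor
    rw [hπ, Measure.sum_apply _ MeasurableSet.univ]
    have h1 : ∀ n, (p n • kingmanPow s N n) univ = ENNReal.ofReal ((p n : ℝ) * m ^ n) := by
      intro n
      rw [Measure.smul_apply, kingmanPow_univ hs, ENNReal.smul_def, smul_eq_mul,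
        ENNReal.ofReal_mul (by positivity), ENNReal.ofReal_coe_nnreal,
        ENNReal.ofReal_pow (by positivity), hm, ofReal_measureReal]
    simp only [h1]
    rw [← ENNReal.ofReal_tsum_of_nonneg (fun n => by positivity) (hexp m).summable,
      (hexp m).tsum_eq, ← Real.exp_add]
    simp
  refine ⟨π, hprob, fun t => ?_⟩
  have h1 := radCharFun_sum hs (fun n => p n • kingmanPow s N n) t
  have h2 : ∀ n, radCharFun s (p n • kingmanPow s N n) t = (p n : ℝ) * radCharFun s N t ^ n := by
    intro n
    rw [← radCharFun_kingmanPow hs]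
    unfold radCharFun
    rw [integral_smul_nnreal_measure, NNReal.smul_def, smul_eq_mul]
  simp only [h2] at h1
  rw [h1.unique (hexp (radCharFun s N t)), ← Real.exp_add, integral_one_sub_kingmanKernelPi hs]
  congr 1
  ring

/-- The Lévy-Khinchine exponent of the pair `[M, l]`. -/
noncomputable def levyExponent (s : ℝ) (M : Measure (Fin k → ℝ≥0)) (l t : Fin k → ℝ≥0) : ℝ :=
  ∑ j, (l j : ℝ) ^ 2 * (t j : ℝ) ^ 2 + ∫ x, levyIntegrand s t x ∂M

lemma tendsto_levyExponent (hs : -(1 / 2) ≤ s) (M : Measure (Fin k → ℝ≥0)) [IsFiniteMeasure M]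
    (l : Fin k → ℝ≥0) : Tendsto (levyExponent s M l) (𝓝 0) (𝓝 0) := by
  have h1 : Tendsto (fun t : Fin k → ℝ≥0 => ∑ j, (l j : ℝ) ^ 2 * (t j : ℝ) ^ 2) (𝓝 0) (𝓝 0) := by
    have hc : Continuous fun t : Fin k → ℝ≥0 => ∑ j, (l j : ℝ) ^ 2 * (t j : ℝ) ^ 2 := by fun_prop
    simpa using hc.tendsto 0
  have h2 : Tendsto (fun t => ∫ x, levyIntegrand s t x ∂M) (𝓝 0) (𝓝 (∫ _, (0 : ℝ) ∂M)) := by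
    refine tendsto_integral_filter_of_dominated_convergence (fun _ => 3) ?_ ?_
      (integrable_const _) ?_
    · exact .of_forall fun t => (measurable_levyIntegrand hs t).aestronglyMeasurable
    · filter_upwards [tendsto_coneNormSq.eventually_lt_const one_pos] with t ht
      refine .of_forall fun x => ?_
      rw [Real.norm_of_nonneg (levyIntegrand_nonneg hs t x)]
      linarith [levyIntegrand_le hs t x]
    · refine .of_forall fun x => ?_
      have hc : Continuous fun t => levyIntegrand s t x := by
        simp only [levyIntegrand, kingmanKernelPi_comm s _ x]
        have := continuous_kingmanKernelPi hs x
        fun_prop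
      have := hc.tendsto 0
      simpa [levyIntegrand, kingmanKernelPi_zero_left hs] using this
  have h3 := h1.add h2
  rw [integral_zero, add_zero] at h3
  exact h3

lemma radCharFun_rayleighPi_sqrt (hs : -(1 / 2) ≤ s) (l t : Fin k → ℝ≥0) :
    radCharFun s (rayleighPi s fun j => l j * NNReal.sqrt (4 * (s + 1)).toNNReal) t =
      Real.exp (-∑ j, (l j : ℝ) ^ 2 * (t j : ℝ) ^ 2) := by
  have ha : 0 < s + 1 := by linarith
  rw [radCharFun_rayleighPi hs]
  congr 2
  refine Finset.sum_congr rfl fun j _ => ?_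
  rw [NNReal.coe_mul, mul_pow, Real.coe_sqrt, Real.sq_sqrt (NNReal.coe_nonneg _),
    Real.coe_toNNReal _ (by positivity)]
  field_simp

/-- Exponents of measures carried by the complement of a ball are attained. -/
lemma exists_radCharFun_eq_exp_of_restrict (hs : -(1 / 2) ≤ s) (M : Measure (Fin k → ℝ≥0))
    [IsFiniteMeasure M] (l : Fin k → ℝ≥0) {ε : ℝ} (hε : 0 < ε) :
    ∃ ν : Measure (Fin k → ℝ≥0), IsProbabilityMeasure ν ∧ ∀ t, radCharFun s ν t =
      Real.exp (-levyExponent s (M.restrict {x | ε ≤ coneNormSq x}) l t) := by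
  have hm : MeasurableSet {x : Fin k → ℝ≥0 | ε ≤ coneNormSq x} :=
    measurableSet_le measurable_const continuous_coneNormSq.measurable
  set d : (Fin k → ℝ≥0) → ℝ := fun x => (1 + coneNormSq x) / coneNormSq x with hd
  have hdm : Measurable d := by
    have := (continuous_coneNormSq (k := k)).measurable
    simp only [hd]
    fun_prop
  have hd0 : ∀ x, 0 ≤ d x := fun x =>
    div_nonneg (by linarith [coneNormSq_nonneg x]) (coneNormSq_nonneg x)
  set M' := M.restrict {x | ε ≤ coneNormSq x} with hM'
  -- Where `‖x‖² ≥ ε`, the density is at most `1 / ε + 1`, so the Poisson intensity is finite.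
  have hint : Integrable d M' := by
    refine Integrable.of_bound hdm.aestronglyMeasurable (1 / ε + 1) ?_
    filter_upwards [ae_restrict_mem hm] with x hx
    have hx : ε ≤ coneNormSq x := hx
    have hx0 : 0 < coneNormSq x := lt_of_lt_of_le hε hx
    rw [Real.norm_of_nonneg (hd0 x)]
    simp only [hd]
    rw [add_div, div_self hx0.ne']
    gcongr
  have : IsFiniteMeasure (M'.withDensity fun x => ENNReal.ofReal (d x)) :=
    isFiniteMeasure_withDensity hint.lintegral_lt_top.ne
  obtain ⟨π, hπ, hπt⟩ := exists_compoundPoisson hs (M'.withDensity fun x => ENNReal.ofReal (d x))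
  have := isProbabilityMeasure_rayleighPi hs fun j => l j * NNReal.sqrt (4 * (s + 1)).toNNReal
  refine ⟨kingmanConv s (rayleighPi s fun j => l j * NNReal.sqrt (4 * (s + 1)).toNNReal) π,
    isProbabilityMeasure_kingmanConv hs _ _, fun t => ?_⟩
  rw [radCharFun_kingmanConv hs, radCharFun_rayleighPi_sqrt hs, hπt, ← Real.exp_add,
    integral_withDensity_eq_integral_toReal_smul hdm.ennreal_ofReal (by simp)]
  have h1 : ∀ x, (ENNReal.ofReal (d x)).toReal • (1 - kingmanKernelPi s t x) =
      levyIntegrand s t x := by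
    intro x
    rw [ENNReal.toReal_ofReal (hd0 x), smul_eq_mul, mul_comm]
    rfl
  simp only [h1, levyExponent]
  rw [← neg_add]

/-- Every Lévy-Khinchine exponent is attained. -/
theorem exists_radCharFun_eq_exp (hs : -(1 / 2) ≤ s) (M : Measure (Fin k → ℝ≥0))
    [IsFiniteMeasure M] (l : Fin k → ℝ≥0) :
    ∃ ν : Measure (Fin k → ℝ≥0), IsProbabilityMeasure ν ∧ ∀ t, radCharFun s ν t =
      Real.exp (-levyExponent s M l t) := by
  set A : ℕ → Set (Fin k → ℝ≥0) := fun n => {x | 1 / ((n : ℝ) + 1) ≤ coneNormSq x} with hA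
  have hAm : ∀ n, MeasurableSet (A n) := fun n =>
    measurableSet_le measurable_const continuous_coneNormSq.measurable
  choose ν hν hνt using fun n : ℕ => exists_radCharFun_eq_exp_of_restrict hs M l
    (show (0 : ℝ) < 1 / ((n : ℝ) + 1) by positivity)
  -- `1 - exp (-ψ_n) ≤ ψ_n ≤ ψ`, with `ψ_n` the truncated exponents and `ψ` the full one, which
  -- tends to `0` at the origin; this gives tightness.
  have hquad : HasUniformQuadraticBound s ν := by
    refine hasUniformQuadraticBound_of_le hs ν (tendsto_levyExponent hs M l)
      (.of_forall fun t n => ?_)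
    rw [integral_one_sub_kingmanKernelPi hs, hνt n, probReal_univ]
    have h1 := Real.add_one_le_exp (-levyExponent s (M.restrict (A n)) l t)
    have h2 : levyExponent s (M.restrict (A n)) l t ≤ levyExponent s M l t := by
      exact add_le_add le_rfl (setIntegral_le_integral (integrable_levyIntegrand hs M t)
        (.of_forall fun x => levyIntegrand_nonneg hs t x))
    simp only [hA] at h1 h2
    linarith
  obtain ⟨Q, hQ, hlim⟩ := exists_tendsto_hyperfilter ν fun ε hε => by
    obtain ⟨K, hK, -, hKN⟩ := hquad.exists_isCompact hs hε
    exact ⟨K, hK, hKN⟩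
  refine ⟨Q, hQ, fun t => ?_⟩
  have h1 := hlim (kingmanKernelPi s t) (continuous_kingmanKernelPi hs t)
    ⟨1, abs_kingmanKernelPi_le_one hs t⟩
  have h2 : Tendsto (fun n => ∫ x in A n, levyIntegrand s t x ∂M) atTop
      (𝓝 (∫ x, levyIntegrand s t x ∂M)) := by
    simp only [← integral_indicator (hAm _)]
    refine tendsto_integral_of_dominated_convergence (levyIntegrand s t) (fun n => ?_)
      (integrable_levyIntegrand hs M t) (fun n => .of_forall fun x => ?_) (.of_forall fun x => ?_)
    · exact ((measurable_levyIntegrand hs t).indicator (hAm n)).aestronglyMeasurable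
    · refine (norm_indicator_le_norm_self _ _).trans ?_
      rw [Real.norm_of_nonneg (levyIntegrand_nonneg hs t x)]
    · by_cases hx : x = 0
      · subst hx
        simp [indicator_apply, levyIntegrand_zero hs]
      · refine tendsto_const_nhds.congr' ?_
        filter_upwards [(tendsto_one_div_add_atTop_nhds_zero_nat (𝕜 := ℝ)).eventually_lt_const
          (coneNormSq_pos hx)] with n hn
        rw [indicator_of_mem]
        exact hn.le
  have h3 : Tendsto (fun n => radCharFun s (ν n) t) (hyperfilter ℕ : Filter ℕ)
      (𝓝 (Real.exp (-levyExponent s M l t))) := by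
    simp only [hνt, levyExponent]
    exact ((Real.continuous_exp.tendsto _).comp
      ((h2.const_add _).neg)).mono_left Nat.hyperfilter_le_atTop
  exact tendsto_nhds_unique h1 h3

/-- The pair `[M / m, l / √m]` has exponent `-log μ̂ / m`; a law with that exponent is an `m`-th
root by injectivity of the transform. -/
theorem HasLevyRep.isKingmanID (hs : -(1 / 2) ≤ s) {μ M : Measure (Fin k → ℝ≥0)}
    [IsProbabilityMeasure μ] {l : Fin k → ℝ≥0} (h : HasLevyRep s μ M l) : IsKingmanID s μ := by
  have := h.levy.isFiniteMeasure hs (h.integrable 1)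
  intro m hm
  have hm0 : (0 : ℝ) < m := by exact_mod_cast hm
  obtain ⟨ν, hν, hνt⟩ := exists_radCharFun_eq_exp hs ((m : ℝ≥0)⁻¹ • M)
    fun j => l j * NNReal.sqrt (m : ℝ≥0)⁻¹
  refine ⟨ν, hν, ?_⟩
  have := isProbabilityMeasure_kingmanPow hs ν m
  refine ext_of_radCharFun hs fun t => ?_
  rw [radCharFun_kingmanPow hs, hνt, ← Real.exp_nat_mul]
  have h1 : levyExponent s ((m : ℝ≥0)⁻¹ • M) (fun j => l j * NNReal.sqrt (m : ℝ≥0)⁻¹) t =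
      (m : ℝ)⁻¹ * -Real.log (radCharFun s μ t) := by
    rw [h.eq t, levyExponent, integral_smul_nnreal_measure, mul_add, Finset.mul_sum]
    congr 1
    refine Finset.sum_congr rfl fun j _ => ?_
    rw [NNReal.coe_mul, mul_pow, Real.coe_sqrt, Real.sq_sqrt (NNReal.coe_nonneg _)]
    push_cast
    ring
  rw [h1, mul_neg, mul_inv_cancel_left₀ hm0.ne', neg_neg, Real.exp_log (h.pos t)]

end Representation

theorem mainTheorem3 (k : ℕ) (hk : 1 ≤ k) (s : ℝ) (hs : -(1 / 2) ≤ s)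
    (μ : Measure (Fin k → ℝ≥0)) [IsProbabilityMeasure μ] :
    (IsKingmanID s μ ↔ ∃ (M : Measure (Fin k → ℝ≥0)) (l : Fin k → ℝ≥0), HasLevyRep s μ M l) ∧
    (∀ (M M' : Measure (Fin k → ℝ≥0)) (l l' : Fin k → ℝ≥0),
      HasLevyRep s μ M l → HasLevyRep s μ M' l' → M = M' ∧ l = l') ∧
    ((∃ l : Fin k → ℝ≥0, HasLevyRep s μ 0 l) ↔ IsRayleighian s μ) ∧
    (IsRayleighian s μ ↔ ∃ l : Fin k → ℝ≥0, ∀ t : Fin k → ℝ≥0,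
      0 < radCharFun s μ t ∧
        -Real.log (radCharFun s μ t) = 1 / 2 * ∑ j, (l j : ℝ) ^ 2 * (t j : ℝ) ^ 2) := by
  refine ⟨⟨fun h => h.exists_hasLevyRep hs, fun ⟨M, l, h⟩ => h.isKingmanID hs⟩,
    fun M M' l l' h h' => h.unique hs h', ?_, ?_⟩
  · rw [isRayleighian_iff hs μ one_pos]
    exact exists_congr fun l => hasLevyRep_zero_iff μ l
  · rw [isRayleighian_iff hs μ (half_pos one_pos)]
    exact exists_congr fun l => forall_congr' fun t => pos_and_neg_log_eq_iff.symm
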